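/- Let $p\ge 0$, let $\mathfrak g'=\mathfrak{sp}(2p,\mathbb C)$ be the Lie algebra of block matrices $\begin{pmatrix}X&Y\\Z&-X^T\end{pmatrix}$ with $X,Y,Z\in M_p(\mathbb C)$, $Y=Y^T$, $Z=Z^T$, and let $\mathfrak k'\cong\mathfrak{gl}_p(\mathbb C)$, $\mathfrak p^+$, $\mathfrak p^-$ be its subspaces given by $Y=Z=0$, by $X=Z=0$ and by $X=Y=0$, respectively. Put $\mathfrak q^\pm=\mathfrak k'+\mathfrak p^\pm$. Let $K'=U(p)$, embedded by $k\mapsto\begin{pmatrix}k&0\\0&k^{-T}\end{pmatrix}$, so that $\mathfrak k'$ is the complexified Lie algebra of $K'$. For $\mathfrak l=\mathfrak g'$ or $\mathfrak l=\mathfrak k'$, an $(\mathfrak l,K')$-module is a complex vector space $V$ with linear actions of $\mathfrak l$ and of $K'$ such that (1) $k\cdot(X\cdot v)=(\mathrm{Ad}(k)X)\cdot(k\cdot v)$ for $k\in K'$, $X\in\mathfrak l$, $v\in V$; (2) the span of $K'\cdot v$ is finite-dimensional for every $v\in V$; (3) $\frac{d}{dt}\exp(tY)\cdot v\,|_{t=0}=Y\cdot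 v$ for every $v\in V$ and every $Y$ in the real Lie algebra $\mathfrak u(p)$ of $K'$. Homomorphisms are the linear maps that commute with both actions. A $(\mathfrak g',K')$-module $P$ is projective if for all $(\mathfrak g',K')$-modules $M,N$, every surjective homomorphism $f:N\to M$ and every homomorphism $g:P\to M$ there is a homomorphism $h:P\to N$ with $f\circ h=g$. Let $E$ and $F$ be finite-dimensional $\mathfrak k'$-modules such that the $\mathfrak k'$-module $E\otimes F$ is a $(\mathfrak k',K')$-module for some action of $K'$ (for instance, such that $E$ and $F$ are themselves $(\mathfrak k',K')$-modules). Let $\mathfrak p^+$ act by zero on $E$ and $\mathfrak p^-$ by zero on $F$, and form the generalized Verma modules $$V_E=U(\mathfrak g')\otimes_{U(\mathfrak q^+)}E,\qquad V_F=U(\mathfrak g')\otimes_{U(\mathfrak q^-)}F .$$ Then there is an action of $K'$ that makes the $\mathfrak g'$-module $V_E\otimes V_F$ (tensor products over $\mathbb C$, with the diagonal action of $\mathfrak g'$) a $(\mathfrak g',K')$-module, and with every such action $V_E\otimes V_F$ is a projective $(\mathfrak g',K')$-module. -/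

import Mathlib

open scoped TensorProduct Matrix

universe u v w

noncomputable section

attribute [local instance 100] LieRing.ofAssociativeRing

/-! ### Induced modules -/

section Induced

variable {L : Type*} [LieRing L] [LieAlgebra ℂ L] {E : Type*} [AddCommGroup E] [Module ℂ E]

/-- The canonical homomorphism of enveloping algebras `U(H) → U(L)`, for a Lie subalgebra `H`. -/
def envelopingIncl (H : LieSubalgebra ℂ L) :
    UniversalEnvelopingAlgebra ℂ H →ₐ[ℂ] UniversalEnvelopingAlgebra ℂ L :=
  UniversalEnvelopingAlgebra.lift ℂ ((UniversalEnvelopingAlgebra.ι ℂ).comp H.incl)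

/-- The relations `u a ⊗ e = u ⊗ a e` (`u ∈ U(L)`, `a ∈ U(H)`, `e ∈ E`), where `U(H)` acts on `E`
through the extension of the representation `φ` of `H`. -/
def inducedRel (H : LieSubalgebra ℂ L) (φ : H →ₗ⁅ℂ⁆ Module.End ℂ E) :
    Submodule (UniversalEnvelopingAlgebra ℂ L) (UniversalEnvelopingAlgebra ℂ L ⊗[ℂ] E) :=
  Submodule.span _ {x | ∃ (u : UniversalEnvelopingAlgebra ℂ L)
    (a : UniversalEnvelopingAlgebra ℂ H) (e : E),
    x = (u * envelopingIncl H a) ⊗ₜ[ℂ] e - u ⊗ₜ[ℂ] (UniversalEnvelopingAlgebra.lift ℂ φ a e)}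

/-- The induced module `U(L) ⊗_{U(H)} E`, for a representation `φ` of `H` on `E`. -/
def Induced (H : LieSubalgebra ℂ L) (φ : H →ₗ⁅ℂ⁆ Module.End ℂ E) :=
  (UniversalEnvelopingAlgebra ℂ L ⊗[ℂ] E) ⧸ inducedRel H φ

namespace Induced

variable (H : LieSubalgebra ℂ L) (φ : H →ₗ⁅ℂ⁆ Module.End ℂ E)

instance : AddCommGroup (Induced H φ) :=
  inferInstanceAs (AddCommGroup ((UniversalEnvelopingAlgebra ℂ L ⊗[ℂ] E) ⧸ inducedRel H φ))

instance : Module (UniversalEnvelopingAlgebra ℂ L) (Induced H φ) :=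
  inferInstanceAs (Module (UniversalEnvelopingAlgebra ℂ L)
    ((UniversalEnvelopingAlgebra ℂ L ⊗[ℂ] E) ⧸ inducedRel H φ))

instance : Module ℂ (Induced H φ) :=
  inferInstanceAs (Module ℂ ((UniversalEnvelopingAlgebra ℂ L ⊗[ℂ] E) ⧸ inducedRel H φ))

instance : IsScalarTower ℂ (UniversalEnvelopingAlgebra ℂ L) (Induced H φ) :=
  inferInstanceAs (IsScalarTower ℂ (UniversalEnvelopingAlgebra ℂ L)
    ((UniversalEnvelopingAlgebra ℂ L ⊗[ℂ] E) ⧸ inducedRel H φ))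

/-- `L` acts through left multiplication on `U(L)`. -/
instance : LieRingModule L (Induced H φ) where
  bracket x v := UniversalEnvelopingAlgebra.ι ℂ x • v
  add_lie x y v := by
    change UniversalEnvelopingAlgebra.ι ℂ (x + y) • v = _
    rw [map_add, add_smul]
  lie_add x v w := smul_add (UniversalEnvelopingAlgebra.ι ℂ x) v w
  leibniz_lie x y v := by
    change UniversalEnvelopingAlgebra.ι ℂ x • UniversalEnvelopingAlgebra.ι ℂ y • v =
      UniversalEnvelopingAlgebra.ι ℂ ⁅x, y⁆ • v +
        UniversalEnvelopingAlgebra.ι ℂ y • UniversalEnvelopingAlgebra.ι ℂ x • v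
    rw [LieHom.map_lie, LieRing.of_associative_ring_bracket, sub_smul, mul_smul, mul_smul]
    abel

instance : LieModule ℂ L (Induced H φ) where
  smul_lie c x v := by
    change UniversalEnvelopingAlgebra.ι ℂ (c • x) • v = c • UniversalEnvelopingAlgebra.ι ℂ x • v
    rw [map_smul, smul_assoc]
  lie_smul c x v := by
    change UniversalEnvelopingAlgebra.ι ℂ x • c • v = c • UniversalEnvelopingAlgebra.ι ℂ x • v
    rw [← algebraMap_smul (UniversalEnvelopingAlgebra ℂ L) c v,
      ← algebraMap_smul (UniversalEnvelopingAlgebra ℂ L) c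
        (UniversalEnvelopingAlgebra.ι ℂ x • v), ← mul_smul, ← mul_smul, Algebra.commutes]

end Induced

end Induced

/-! ### The symplectic Lie algebra and its subalgebras -/

/-- `sp(2p, ℂ)`. -/
abbrev Sp (p : ℕ) : LieSubalgebra ℂ (Matrix (Fin p ⊕ Fin p) (Fin p ⊕ Fin p) ℂ) :=
  LieAlgebra.Symplectic.sp (Fin p) ℂ

/-- A block matrix lies in `sp(2p, ℂ)` if and only if it is of the form `(X, Y; Z, -Xᵀ)` with
`Y` and `Z` symmetric. -/
theorem fromBlocks_mem_sp {p : ℕ} (X Y Z W : Matrix (Fin p) (Fin p) ℂ) :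
    Matrix.fromBlocks X Y Z W ∈ Sp p ↔ Yᵀ = Y ∧ Zᵀ = Z ∧ W = -Xᵀ := by
  have hsp : Sp p = skewAdjointMatricesLieSubalgebra (Matrix.J (Fin p) ℂ) := rfl
  rw [hsp, mem_skewAdjointMatricesLieSubalgebra,
    mem_skewAdjointMatricesSubmodule, Matrix.IsSkewAdjoint, Matrix.IsAdjointPair]
  simp only [Matrix.J, Matrix.fromBlocks_transpose, Matrix.fromBlocks_multiply,
    Matrix.fromBlocks_neg, Matrix.fromBlocks_inj]
  simp only [mul_zero, mul_one, zero_add, mul_neg, add_zero, zero_mul, neg_mul, one_mul, neg_neg, neg_zero]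
  constructor
  · rintro ⟨h1, h2, h3, h4⟩
    exact ⟨neg_injective h4, h1, h2 ▸ rfl⟩
  · rintro ⟨h1, h2, rfl⟩
    refine ⟨h2, rfl, ?_, ?_⟩
    · simp
    · rw [h1]

theorem toBlocks₁₂_mul {p : ℕ} (A B : Matrix (Fin p ⊕ Fin p) (Fin p ⊕ Fin p) ℂ) :
    (A * B).toBlocks₁₂ = A.toBlocks₁₁ * B.toBlocks₁₂ + A.toBlocks₁₂ * B.toBlocks₂₂ := by
  ext i j
  simp [Matrix.toBlocks₁₁, Matrix.toBlocks₁₂, Matrix.toBlocks₂₂, Matrix.mul_apply]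

theorem toBlocks₂₁_mul {p : ℕ} (A B : Matrix (Fin p ⊕ Fin p) (Fin p ⊕ Fin p) ℂ) :
    (A * B).toBlocks₂₁ = A.toBlocks₂₁ * B.toBlocks₁₁ + A.toBlocks₂₂ * B.toBlocks₂₁ := by
  ext i j
  simp [Matrix.toBlocks₁₁, Matrix.toBlocks₂₁, Matrix.toBlocks₂₂, Matrix.mul_apply]

/-- `𝔮⁺ = 𝔨 + 𝔭⁺ = {(X, Y; 0, -Xᵀ) | Y = Yᵀ}`. -/
def qPlus (p : ℕ) : LieSubalgebra ℂ (Sp p) where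
  carrier := {A | A.1.toBlocks₂₁ = 0}
  zero_mem' := rfl
  add_mem' h1 h2 := (congrArg₂ (· + ·) h1 h2).trans (add_zero 0)
  smul_mem' c _ h := (congrArg (c • ·) h).trans (smul_zero c)
  lie_mem' {A B} h1 h2 := by
    change (A.1 * B.1 - B.1 * A.1).toBlocks₂₁ = 0
    change (A.1 * B.1).toBlocks₂₁ - (B.1 * A.1).toBlocks₂₁ = 0
    have h1 : A.1.toBlocks₂₁ = 0 := h1
    have h2 : B.1.toBlocks₂₁ = 0 := h2
    simp [toBlocks₂₁_mul, h1, h2]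

/-- `𝔮⁻ = 𝔨 + 𝔭⁻ = {(X, 0; Z, -Xᵀ) | Z = Zᵀ}`. -/
def qMinus (p : ℕ) : LieSubalgebra ℂ (Sp p) where
  carrier := {A | A.1.toBlocks₁₂ = 0}
  zero_mem' := rfl
  add_mem' h1 h2 := (congrArg₂ (· + ·) h1 h2).trans (add_zero 0)
  smul_mem' c _ h := (congrArg (c • ·) h).trans (smul_zero c)
  lie_mem' {A B} h1 h2 := by
    change (A.1 * B.1 - B.1 * A.1).toBlocks₁₂ = 0
    change (A.1 * B.1).toBlocks₁₂ - (B.1 * A.1).toBlocks₁₂ = 0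
    have h1 : A.1.toBlocks₁₂ = 0 := h1
    have h2 : B.1.toBlocks₁₂ = 0 := h2
    simp [toBlocks₁₂_mul, h1, h2]

/-- `𝔨 = {(X, 0; 0, -Xᵀ)} ≅ gl(p, ℂ)`. -/
def kAlg (p : ℕ) : LieSubalgebra ℂ (Sp p) := qPlus p ⊓ qMinus p

theorem mem_kAlg_iff {p : ℕ} (A : Sp p) :
    A ∈ kAlg p ↔ ∃ X : Matrix (Fin p) (Fin p) ℂ, A.1 = Matrix.fromBlocks X 0 0 (-Xᵀ) := by
  have hA := A.2
  rw [← Matrix.fromBlocks_toBlocks A.1, fromBlocks_mem_sp] at hA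
  constructor
  · rintro ⟨h1, h2⟩
    refine ⟨A.1.toBlocks₁₁, ?_⟩
    have h1 : A.1.toBlocks₂₁ = 0 := h1
    have h2 : A.1.toBlocks₁₂ = 0 := h2
    conv_lhs => rw [← Matrix.fromBlocks_toBlocks A.1]
    rw [h1, h2, hA.2.2]
  · rintro ⟨X, hX⟩
    refine ⟨?_, ?_⟩
    · change A.1.toBlocks₂₁ = 0
      simp [hX]
    · change A.1.toBlocks₁₂ = 0
      simp [hX]

/-- The block diagonal matrix `(X, 0; 0, -Xᵀ)` as an element of `𝔨`. -/
def kDiag {p : ℕ} (X : Matrix (Fin p) (Fin p) ℂ) : kAlg p :=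
  ⟨⟨Matrix.fromBlocks X 0 0 (-Xᵀ), by simp [fromBlocks_mem_sp]⟩, by
    rw [mem_kAlg_iff]; exact ⟨X, rfl⟩⟩

theorem kDiag_lie {p : ℕ} (X Y : Matrix (Fin p) (Fin p) ℂ) :
    kDiag ⁅X, Y⁆ = ⁅kDiag X, kDiag Y⁆ := by
  apply Subtype.ext
  apply Subtype.ext
  change Matrix.fromBlocks _ _ _ _ = Matrix.fromBlocks _ _ _ _ * Matrix.fromBlocks _ _ _ _ -
    Matrix.fromBlocks _ _ _ _ * Matrix.fromBlocks _ _ _ _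
  rw [Matrix.fromBlocks_multiply, Matrix.fromBlocks_multiply, sub_eq_add_neg,
    Matrix.fromBlocks_neg, Matrix.fromBlocks_add]
  simp [LieRing.of_associative_ring_bracket, Matrix.transpose_mul, sub_eq_add_neg]

/-- The projection `𝔮⁺ = 𝔨 + 𝔭⁺ → 𝔨` with kernel `𝔭⁺`. -/
def projPlus (p : ℕ) : qPlus p →ₗ⁅ℂ⁆ kAlg p where
  toFun A := kDiag A.1.1.toBlocks₁₁
  map_add' A B := by
    apply Subtype.ext
    apply Subtype.ext
    change Matrix.fromBlocks _ _ _ _ = Matrix.fromBlocks _ _ _ _ + Matrix.fromBlocks _ _ _ _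
    rw [Matrix.fromBlocks_add]
    simp [Matrix.toBlocks₁₁, add_comm, ← Matrix.ext_iff]
  map_smul' c A := by
    apply Subtype.ext
    apply Subtype.ext
    change Matrix.fromBlocks _ _ _ _ = c • Matrix.fromBlocks _ _ _ _
    rw [Matrix.fromBlocks_smul]
    simp [Matrix.toBlocks₁₁, ← Matrix.ext_iff]
  map_lie' {A B} := by
    have hA : A.1.1.toBlocks₂₁ = 0 := A.2
    have hB : B.1.1.toBlocks₂₁ = 0 := B.2
    change kDiag _ = ⁅kDiag _, kDiag _⁆
    rw [← kDiag_lie, LieRing.of_associative_ring_bracket]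
    congr 1
    change (A.1.1 * B.1.1 - B.1.1 * A.1.1).toBlocks₁₁ = _
    ext i j
    have hA' : ∀ i j, A.1.1 (Sum.inr i) (Sum.inl j) = 0 := fun i j => congrFun₂ hA i j
    have hB' : ∀ i j, B.1.1 (Sum.inr i) (Sum.inl j) = 0 := fun i j => congrFun₂ hB i j
    simp [Matrix.toBlocks₁₁, Matrix.mul_apply, hA', hB']

/-- The projection `𝔮⁻ = 𝔨 + 𝔭⁻ → 𝔨` with kernel `𝔭⁻`. -/
def projMinus (p : ℕ) : qMinus p →ₗ⁅ℂ⁆ kAlg p where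
  toFun A := kDiag A.1.1.toBlocks₁₁
  map_add' A B := by
    apply Subtype.ext
    apply Subtype.ext
    change Matrix.fromBlocks _ _ _ _ = Matrix.fromBlocks _ _ _ _ + Matrix.fromBlocks _ _ _ _
    rw [Matrix.fromBlocks_add]
    simp [Matrix.toBlocks₁₁, add_comm, ← Matrix.ext_iff]
  map_smul' c A := by
    apply Subtype.ext
    apply Subtype.ext
    change Matrix.fromBlocks _ _ _ _ = c • Matrix.fromBlocks _ _ _ _
    rw [Matrix.fromBlocks_smul]
    simp [Matrix.toBlocks₁₁, ← Matrix.ext_iff]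
  map_lie' {A B} := by
    have hA : A.1.1.toBlocks₁₂ = 0 := A.2
    have hB : B.1.1.toBlocks₁₂ = 0 := B.2
    change kDiag _ = ⁅kDiag _, kDiag _⁆
    rw [← kDiag_lie, LieRing.of_associative_ring_bracket]
    congr 1
    change (A.1.1 * B.1.1 - B.1.1 * A.1.1).toBlocks₁₁ = _
    ext i j
    have hA' : ∀ i j, A.1.1 (Sum.inl i) (Sum.inr j) = 0 := fun i j => congrFun₂ hA i j
    have hB' : ∀ i j, B.1.1 (Sum.inl i) (Sum.inr j) = 0 := fun i j => congrFun₂ hB i j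
    simp [Matrix.toBlocks₁₁, Matrix.mul_apply, hA', hB']

/-! ### Generalized Verma modules -/

section Verma

variable (p : ℕ) (E : Type*) [AddCommGroup E] [Module ℂ E] [LieRingModule (kAlg p) E]
  [LieModule ℂ (kAlg p) E]

/-- `U(sp(2p, ℂ)) ⊗_{U(𝔮⁺)} E`, where `𝔭⁺` acts by zero on the `𝔨`-module `E`. -/
abbrev VermaPlus :=
  Induced (qPlus p) ((LieModule.toEnd ℂ (kAlg p) E).comp (projPlus p))

/-- `U(sp(2p, ℂ)) ⊗_{U(𝔮⁻)} E`, where `𝔭⁻` acts by zero on the `𝔨`-module `E`. -/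
abbrev VermaMinus :=
  Induced (qMinus p) ((LieModule.toEnd ℂ (kAlg p) E).comp (projMinus p))

end Verma

/-! ### The group `K = U(p)`, embedded as `k ↦ (k, 0; 0, k⁻ᵀ)` in `Sp(2p, ℂ)` -/

/-- `U(p)`. -/
abbrev U (p : ℕ) := Matrix.unitaryGroup (Fin p) ℂ

/-- The matrix `(k, 0; 0, k⁻ᵀ)`. -/
def kMat {p : ℕ} (k : U p) : Matrix (Fin p ⊕ Fin p) (Fin p ⊕ Fin p) ℂ :=
  Matrix.fromBlocks k.1 0 0 ((k⁻¹ : U p).1)ᵀ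

/-- The adjoint action of `U(p)` on `sp(2p, ℂ)`. -/
def Ad {p : ℕ} (k : U p) (A : Sp p) : Sp p :=
  ⟨kMat k * A.1 * kMat k⁻¹, by
    have hA := A.2
    rw [← Matrix.fromBlocks_toBlocks A.1] at hA ⊢
    simp only [kMat, Matrix.fromBlocks_multiply, inv_inv]
    rw [fromBlocks_mem_sp] at hA ⊢
    obtain ⟨h1, h2, h3⟩ := hA
    rw [h3]
    simp [Matrix.transpose_mul, h1, h2, Matrix.mul_assoc]⟩

theorem Ad_kDiag {p : ℕ} (k : U p) (X : Matrix (Fin p) (Fin p) ℂ) :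
    Ad k (kDiag X).1 = (kDiag (k.1 * X * (k⁻¹ : U p).1)).1 := by
  apply Subtype.ext
  change kMat k * Matrix.fromBlocks _ _ _ _ * kMat k⁻¹ = Matrix.fromBlocks _ _ _ _
  simp [kMat, Matrix.fromBlocks_multiply, Matrix.transpose_mul, Matrix.mul_assoc]

/-- The adjoint action of `U(p)` on `𝔨`. -/
def AdK {p : ℕ} (k : U p) (A : kAlg p) : kAlg p :=
  ⟨Ad k A.1, by
    obtain ⟨X, hX⟩ := (mem_kAlg_iff A.1).1 A.2
    have : A.1 = (kDiag X).1 := Subtype.ext hX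
    rw [this, Ad_kDiag]
    exact (kDiag _).2⟩

/-- The one-parameter subgroup `t ↦ exp(t Y)` of `U(p)`, for `Y` in the (real) Lie algebra
`𝔲(p)` of skew-Hermitian matrices. -/
def expU {p : ℕ} (Y : skewAdjoint (Matrix (Fin p) (Fin p) ℂ)) (t : ℝ) : U p :=
  ⟨NormedSpace.exp (t • Y.1), by
    have h : (t • Y.1)ᴴ = -(t • Y.1) := by
      have := Y.2
      rw [skewAdjoint.mem_iff, Matrix.star_eq_conjTranspose] at this
      rw [Matrix.conjTranspose_smul, this]
      simp
    rw [Matrix.mem_unitaryGroup_iff, Matrix.star_eq_conjTranspose, ← Matrix.exp_conjTranspose, h,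
      ← Matrix.exp_add_of_commute _ _ (Commute.neg_right (Commute.refl (t • Y.1))),
      add_neg_cancel, NormedSpace.exp_zero]⟩

/-! ### `(𝔤, K)`-modules -/

/-- The conditions on a vector space `V` with actions of a complex Lie algebra `L` and (by `ρ`)
of `U(p)` to be an `(L, U(p))`-module, where `Adj` is the adjoint action of `U(p)` on `L` and `d` is
the inclusion of the real Lie algebra `𝔲(p)` into `L`. Given that the span of the orbit of `v` is
finite-dimensional, the last condition says that `t ↦ exp(tY) v` is differentiable at `0` in a
finite-dimensional subspace with derivative `Y v`: it is tested against all linear forms on `V`. -/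
structure IsHCModule {p : ℕ} {L : Type*} [LieRing L] [LieAlgebra ℂ L] (Adj : U p → L → L)
    (d : skewAdjoint (Matrix (Fin p) (Fin p) ℂ) → L) {V : Type*} [AddCommGroup V] [Module ℂ V]
    [LieRingModule L V] [LieModule ℂ L V] (ρ : Representation ℂ (U p) V) : Prop where
  compat : ∀ (k : U p) (X : L) (v : V), ρ k ⁅X, v⁆ = ⁅Adj k X, ρ k v⁆
  finite : ∀ v : V, FiniteDimensional ℂ (Submodule.span ℂ (Set.range fun k : U p => ρ k v))
  deriv : ∀ (Y : skewAdjoint (Matrix (Fin p) (Fin p) ℂ)) (v : V) (l : Module.Dual ℂ V),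
    HasDerivAt (fun t : ℝ => l (ρ (expU Y t) v)) (l ⁅d Y, v⁆) 0

section GK

variable {p : ℕ}

/-- `(𝔨, K)`-modules, for `𝔨 ≅ gl(p, ℂ)` and `K = U(p)`. -/
def IsKKModule {W : Type*} [AddCommGroup W] [Module ℂ W] [LieRingModule (kAlg p) W]
    [LieModule ℂ (kAlg p) W] (σ : Representation ℂ (U p) W) : Prop :=
  IsHCModule (L := kAlg p) AdK (fun Y => kDiag Y.1) σ

/-- `(𝔤, K)`-modules, for `𝔤 = sp(2p, ℂ)` and `K = U(p)`. -/
def IsGKModule {V : Type*} [AddCommGroup V] [Module ℂ V] [LieRingModule (Sp p) V]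
    [LieModule ℂ (Sp p) V] (ρ : Representation ℂ (U p) V) : Prop :=
  IsHCModule (L := Sp p) Ad (fun Y => (kDiag Y.1).1) ρ

/-- A `𝔤`-module homomorphism is a `(𝔤, K)`-module homomorphism if it also commutes with `K`. -/
def IsKEquivariant {V W : Type*} [AddCommGroup V] [Module ℂ V] [LieRingModule (Sp p) V]
    [AddCommGroup W] [Module ℂ W] [LieRingModule (Sp p) W]
    (ρ : Representation ℂ (U p) V) (τ : Representation ℂ (U p) W) (f : V →ₗ⁅ℂ, Sp p⁆ W) : Prop :=
  ∀ (k : U p) (v : V), f (ρ k v) = τ k (f v)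

/-- Projective objects among `(sp(2p, ℂ), U(p))`-modules: homomorphisms out of `P` lift along
surjective homomorphisms `N → M`. The universe `w` of the test modules is arbitrary. -/
def IsProjectiveGKModule {P : Type u} [AddCommGroup P] [Module ℂ P] [LieRingModule (Sp p) P]
    [LieModule ℂ (Sp p) P] (ρ : Representation ℂ (U p) P) : Prop :=
  IsGKModule ρ ∧
  ∀ (M N : Type w) [AddCommGroup M] [Module ℂ M] [LieRingModule (Sp p) M] [LieModule ℂ (Sp p) M]
    [AddCommGroup N] [Module ℂ N] [LieRingModule (Sp p) N] [LieModule ℂ (Sp p) N]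
    (μ : Representation ℂ (U p) M) (ν : Representation ℂ (U p) N),
    IsGKModule μ → IsGKModule ν →
    ∀ (f : N →ₗ⁅ℂ, Sp p⁆ M) (g : P →ₗ⁅ℂ, Sp p⁆ M), IsKEquivariant ν μ f → IsKEquivariant ρ μ g →
      Function.Surjective f →
      ∃ h : P →ₗ⁅ℂ, Sp p⁆ N, IsKEquivariant ρ ν h ∧ f.comp h = g

end GK

end

/-! The point is that `V_E ⊗ V_F` has the universal property of `U(𝔤) ⊗_{U(𝔨)} (E ⊗ F)`: every
`𝔨`-map from `E ⊗ F` to a `𝔤`-module extends uniquely to a `𝔤`-map on `V_E ⊗ V_F`. A lifting problem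
over `𝔤` thus becomes one for the finite-dimensional `K`-module `E ⊗ F`, which averaging over the
compact group `U(p)` solves.

For the universal property only `𝔤 = 𝔮⁺ + 𝔮⁻` and `𝔨 = 𝔮⁺ ∩ 𝔮⁻` matter. Restricted to `𝔮⁺`, the
module `V_F` behaves like `U(𝔮⁺) ⊗_{U(𝔨)} F`. This is proved without the Poincaré–Birkhoff–Witt
theorem, by extending the `𝔮⁺`-action on the latter module to `𝔤` (`exists_extended_action`).
Adjunctions between tensor products and spaces of linear maps then give `tensor_exists_lift`;
`tensor_mem_of_lie_mem` gives uniqueness.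

The passage between `K` and `𝔨` rests on surjectivity of `exp : 𝔲(p) → U(p)`: for locally finite
differentiable actions, linear over `𝔲(p)` is the same as equivariant under `U(p)` (`map_apply`,
`map_derivative`). Averaging needs continuous matrix coefficients, which follow from
differentiability along one-parameter groups (`IsSmoothRep.continuous`). The action of `K` on `V_E ⊗
V_F` itself comes from the universal property applied to modules twisted by `Ad k`. -/

noncomputable section

attribute [local instance 100] LieRing.ofAssociativeRing

/-! ### Generation and universal property of induced modules. -/

namespace Induced

variable {L : Type*} [LieRing L] [LieAlgebra ℂ L] {E : Type*} [AddCommGroup E] [Module ℂ E]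
  (H : LieSubalgebra ℂ L) (φ : H →ₗ⁅ℂ⁆ Module.End ℂ E)

/-- The canonical map `e ↦ 1 ⊗ e` from `E` to the induced module. -/
def incl : E →ₗ[ℂ] Induced H φ where
  toFun e := (inducedRel H φ).mkQ (1 ⊗ₜ[ℂ] e)
  map_add' e e' := by rw [TensorProduct.tmul_add, map_add]; rfl
  map_smul' c e := by
    rw [TensorProduct.tmul_smul]
    exact map_smul ((inducedRel H φ).mkQ.restrictScalars ℂ) c _

theorem mkQ_tmul (a : UniversalEnvelopingAlgebra ℂ L) (e : E) :
    ((inducedRel H φ).mkQ (a ⊗ₜ[ℂ] e) : Induced H φ) = a • incl H φ e := by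
  have h : a ⊗ₜ[ℂ] e = a • ((1 : UniversalEnvelopingAlgebra ℂ L) ⊗ₜ[ℂ] e) := by
    rw [TensorProduct.smul_tmul', smul_eq_mul, mul_one]
  rw [h, map_smul]
  rfl

theorem lie_incl (x : H) (e : E) : ⁅(x : L), incl H φ e⁆ = incl H φ (φ x e) := by
  change UniversalEnvelopingAlgebra.ι ℂ (x : L) • incl H φ e = _
  rw [← mkQ_tmul]
  refine (Submodule.Quotient.eq _).2 (Submodule.subset_span
    ⟨1, UniversalEnvelopingAlgebra.ι ℂ x, e, ?_⟩)
  rw [one_mul, envelopingIncl, UniversalEnvelopingAlgebra.lift_ι_apply,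
    UniversalEnvelopingAlgebra.lift_ι_apply]
  rfl

/-- The elements of `U(L)` that preserve `T` form a subalgebra `S` containing `L`. The inclusion of
`L` extends to `U(L) → S`, and `U(L) → S → U(L)` is the identity because it fixes `L`; hence `S` is
everything. -/
theorem smul_mem_of_lie_mem (T : Submodule ℂ (Induced H φ))
    (hT : ∀ (x : L), ∀ v ∈ T, ⁅x, v⁆ ∈ T) (a : UniversalEnvelopingAlgebra ℂ L) :
    ∀ v ∈ T, a • v ∈ T := by
  let S : Subalgebra ℂ (UniversalEnvelopingAlgebra ℂ L) :=
    { carrier := {a | ∀ v ∈ T, a • v ∈ T}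
      mul_mem' := fun {a b} ha hb v hv => by rw [mul_smul]; exact ha _ (hb _ hv)
      add_mem' := fun {a b} ha hb v hv => by rw [add_smul]; exact T.add_mem (ha _ hv) (hb _ hv)
      algebraMap_mem' := fun c v hv => by rw [algebraMap_smul]; exact T.smul_mem c hv }
  let j : L →ₗ⁅ℂ⁆ S :=
    { toFun := fun x => ⟨UniversalEnvelopingAlgebra.ι ℂ x, hT x⟩
      map_add' := fun x y => Subtype.ext (map_add _ x y)
      map_smul' := fun c x => Subtype.ext (map_smul (UniversalEnvelopingAlgebra.ι ℂ) c x)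
      map_lie' := fun {x y} => Subtype.ext (LieHom.map_lie _ x y) }
  have h : S.val.comp (UniversalEnvelopingAlgebra.lift ℂ j) = AlgHom.id ℂ _ := by
    apply UniversalEnvelopingAlgebra.hom_ext
    ext x
    simp [j]
  have ha := (UniversalEnvelopingAlgebra.lift ℂ j a).2
  rwa [show ((UniversalEnvelopingAlgebra.lift ℂ j a : S) : UniversalEnvelopingAlgebra ℂ L) = a from
    DFunLike.congr_fun h a] at ha

/-- The induced module is generated by `E`. -/
theorem mem_of_lie_mem (T : Submodule ℂ (Induced H φ)) (hE : ∀ e, incl H φ e ∈ T)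
    (hT : ∀ (x : L), ∀ v ∈ T, ⁅x, v⁆ ∈ T) (v : Induced H φ) : v ∈ T := by
  obtain ⟨t, rfl⟩ := (inducedRel H φ).mkQ_surjective v
  induction t using TensorProduct.induction_on with
  | zero => exact T.zero_mem
  | tmul a e => exact (mkQ_tmul H φ a e) ▸ smul_mem_of_lie_mem H φ T hT a _ (hE e)
  | add s t hs ht => exact (map_add (inducedRel H φ).mkQ s t) ▸ T.add_mem hs ht

/-- The universal property of the induced module. -/
theorem exists_lift {N : Type*} [AddCommGroup N] [Module ℂ N] (π : L →ₗ⁅ℂ⁆ Module.End ℂ N)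
    (f : E →ₗ[ℂ] N) (hf : ∀ (x : H) e, f (φ x e) = π x (f e)) :
    ∃ Ψ : Induced H φ →ₗ[ℂ] N, (∀ x v, Ψ ⁅x, v⁆ = π x (Ψ v)) ∧ ∀ e, Ψ (incl H φ e) = f e := by
  let π' := UniversalEnvelopingAlgebra.lift ℂ π
  let _ : Module (UniversalEnvelopingAlgebra ℂ L) N := Module.compHom N π'.toRingHom
  have hsmul : ∀ (a : UniversalEnvelopingAlgebra ℂ L) (n : N), a • n = π' a n := fun _ _ => rfl
  have : IsScalarTower ℂ (UniversalEnvelopingAlgebra ℂ L) N := ⟨fun c a n => by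
    rw [hsmul, hsmul, map_smul]; rfl⟩
  have : SMulCommClass (UniversalEnvelopingAlgebra ℂ L) ℂ N := ⟨fun a c n => by
    rw [hsmul, hsmul, map_smul]⟩
  let g : UniversalEnvelopingAlgebra ℂ L ⊗[ℂ] E →ₗ[UniversalEnvelopingAlgebra ℂ L] N :=
    TensorProduct.AlgebraTensorModule.lift
      (LinearMap.toSpanSingleton (UniversalEnvelopingAlgebra ℂ L) (E →ₗ[ℂ] N) f)
  have hg : ∀ a e, g (a ⊗ₜ e) = π' a (f e) := fun _ _ => rfl
  have hext : ∀ (a : UniversalEnvelopingAlgebra ℂ H) (e : E),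
      f (UniversalEnvelopingAlgebra.lift ℂ φ a e) = π' (envelopingIncl H a) (f e) := by
    -- The elements for which the intertwining identity holds form a subalgebra containing `H`,
    -- hence all of `U(H)`, again because `U(H) → S → U(H)` is the identity.
    let S : Subalgebra ℂ (UniversalEnvelopingAlgebra ℂ H) :=
      { carrier := {a | ∀ e, f (UniversalEnvelopingAlgebra.lift ℂ φ a e) =
          π' (envelopingIncl H a) (f e)}
        mul_mem' := fun {a b} ha hb e => by
          rw [map_mul, map_mul, map_mul, Module.End.mul_apply, Module.End.mul_apply, ha, hb]
        add_mem' := fun {a b} ha hb e => by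
          rw [map_add, map_add, map_add, LinearMap.add_apply, LinearMap.add_apply, map_add, ha, hb]
        algebraMap_mem' := fun c e => by
          simp only [AlgHom.commutes, Module.algebraMap_end_apply, map_smul] }
    let j : H →ₗ⁅ℂ⁆ S :=
      { toFun := fun x => ⟨UniversalEnvelopingAlgebra.ι ℂ x, fun e => by
          rw [envelopingIncl, UniversalEnvelopingAlgebra.lift_ι_apply,
            UniversalEnvelopingAlgebra.lift_ι_apply, LieHom.comp_apply,
            UniversalEnvelopingAlgebra.lift_ι_apply, hf]
          rfl⟩
        map_add' := fun x y => Subtype.ext (map_add _ x y)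
        map_smul' := fun c x => Subtype.ext (map_smul (UniversalEnvelopingAlgebra.ι ℂ) c x)
        map_lie' := fun {x y} => Subtype.ext (LieHom.map_lie _ x y) }
    have h : S.val.comp (UniversalEnvelopingAlgebra.lift ℂ j) = AlgHom.id ℂ _ := by
      apply UniversalEnvelopingAlgebra.hom_ext
      ext x
      simp [j]
    intro a
    have ha := (UniversalEnvelopingAlgebra.lift ℂ j a).2
    rwa [show ((UniversalEnvelopingAlgebra.lift ℂ j a : S) : UniversalEnvelopingAlgebra ℂ H) = a
      from DFunLike.congr_fun h a] at ha
  have hker : inducedRel H φ ≤ LinearMap.ker g := by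
    refine Submodule.span_le.2 ?_
    rintro _ ⟨a, b, e, rfl⟩
    rw [SetLike.mem_coe, LinearMap.mem_ker, map_sub, hg, hg, hext, map_mul, Module.End.mul_apply,
      sub_self]
  let Ψ : Induced H φ →ₗ[UniversalEnvelopingAlgebra ℂ L] N := (inducedRel H φ).liftQ g hker
  refine ⟨Ψ.restrictScalars ℂ, fun x v => ?_, fun e => ?_⟩
  · change Ψ (UniversalEnvelopingAlgebra.ι ℂ x • v) = π x (Ψ v)
    rw [map_smul, hsmul, UniversalEnvelopingAlgebra.lift_ι_apply]
  · change g (1 ⊗ₜ e) = f e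
    rw [hg, map_one, Module.End.one_apply]

end Induced

/-- The representation of a Lie algebra on the space of linear maps between two representations. -/
def homRep {L E N : Type*} [LieRing L] [LieAlgebra ℂ L] [AddCommGroup E] [Module ℂ E]
    [AddCommGroup N] [Module ℂ N] (φ : L →ₗ⁅ℂ⁆ Module.End ℂ E) (π : L →ₗ⁅ℂ⁆ Module.End ℂ N) :
    L →ₗ⁅ℂ⁆ Module.End ℂ (E →ₗ[ℂ] N) where
  toFun a :=
    { toFun := fun g => (π a).comp g - g.comp (φ a)
      map_add' := fun g h => by rw [LinearMap.comp_add, LinearMap.add_comp]; abel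
      map_smul' := fun c g => by
        rw [LinearMap.comp_smul, LinearMap.smul_comp, RingHom.id_apply, smul_sub] }
  map_add' a b := by
    ext g e
    change π (a + b) (g e) - g (φ (a + b) e) = π a (g e) - g (φ a e) + (π b (g e) - g (φ b e))
    simp only [map_add, LinearMap.add_apply]
    abel
  map_smul' c a := by
    ext g e
    change π (c • a) (g e) - g (φ (c • a) e) = c • (π a (g e) - g (φ a e))
    simp only [map_smul, LinearMap.smul_apply, smul_sub]
  map_lie' {a b} := by
    ext g e
    change π ⁅a, b⁆ (g e) - g (φ ⁅a, b⁆ e) =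
      (π a (π b (g e) - g (φ b e)) - (π b (g (φ a e)) - g (φ b (φ a e)))) -
      (π b (π a (g e) - g (φ a e)) - (π a (g (φ b e)) - g (φ a (φ b e))))
    simp only [LieHom.map_lie, LieRing.of_associative_ring_bracket, LinearMap.sub_apply,
      Module.End.mul_apply, map_sub]
    abel

namespace Induced

/-! ### Restriction to `A` of a module induced from `B`, when `L = A + B`. -/

section Restriction

variable {L : Type*} [LieRing L] [LieAlgebra ℂ L] {F : Type*} [AddCommGroup F] [Module ℂ F]
  {A B : LieSubalgebra ℂ L}

/-- A linear section of the surjection `A × B → L`. The sum need not be direct, so this is a choice.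
-/
theorem exists_linear_decomposition (hAB : ∀ x : L, ∃ a ∈ A, ∃ b ∈ B, a + b = x) :
    ∃ (α : L →ₗ[ℂ] A) (β : L →ₗ[ℂ] B), ∀ x, (α x : L) + β x = x := by
  let s : (A.toSubmodule × B.toSubmodule) →ₗ[ℂ] L :=
    A.toSubmodule.subtype.coprod B.toSubmodule.subtype
  have hs : LinearMap.range s = ⊤ := by
    refine LinearMap.range_eq_top.2 fun x => ?_
    obtain ⟨a, ha, b, hb, h⟩ := hAB x
    exact ⟨(⟨a, ha⟩, ⟨b, hb⟩), h⟩
  obtain ⟨r, hr⟩ := s.exists_rightInverse_of_surjective hs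
  exact ⟨(LinearMap.fst ℂ _ _).comp r, (LinearMap.snd ℂ _ _).comp r, fun x =>
    LinearMap.congr_fun hr x⟩

/-- The representation of `A ∩ B`, as a subalgebra of `A`, given by a representation of `B`. -/
def restrictInf (A : LieSubalgebra ℂ L) {B : LieSubalgebra ℂ L} (φ : B →ₗ⁅ℂ⁆ Module.End ℂ F) :
    B.comap A.incl →ₗ⁅ℂ⁆ Module.End ℂ F :=
  φ.comp
    { toFun := fun x => ⟨x.1.1, x.2⟩
      map_add' := fun _ _ => rfl
      map_smul' := fun _ _ => rfl
      map_lie' := rfl }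

/-- The action of `A` on the module induced from `A ∩ B` to `A` extends to an action of `L = A + B`
that agrees with the given action of `B` on the generating subspace. -/
theorem exists_extended_action (hAB : ∀ x : L, ∃ a ∈ A, ∃ b ∈ B, a + b = x)
    (φ : B →ₗ⁅ℂ⁆ Module.End ℂ F) :
    ∃ π : L →ₗ⁅ℂ⁆ Module.End ℂ (Induced (B.comap A.incl) (restrictInf A φ)),
      (∀ (a : A) v, π a v = ⁅a, v⁆) ∧
      ∀ (b : B) f, π b (incl _ (restrictInf A φ) f) = incl _ (restrictInf A φ) (φ b f) := by
  obtain ⟨α, β, hαβ⟩ := exists_linear_decomposition hAB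
  set D := Induced (B.comap A.incl) (restrictInf A φ)
  set j : F →ₗ[ℂ] D := incl _ (restrictInf A φ)
  have hjk : ∀ (x : L) (hA : x ∈ A) (hB : x ∈ B) f, ⁅(⟨x, hA⟩ : A), j f⁆ = j (φ ⟨x, hB⟩ f) :=
    fun x hA hB f => lie_incl (B.comap A.incl) (restrictInf A φ) ⟨⟨x, hA⟩, hB⟩ f
  -- The intended value of `x · f`. By `hjk` the actions of `A` and `B` agree on `A ∩ B`, so the
  -- choice of decomposition does not matter; this is the content of `hTA` and `hTB`.
  let T : F →ₗ[ℂ] L →ₗ[ℂ] D := LinearMap.mk₂ ℂ (fun f x => ⁅α x, j f⁆ + j (φ (β x) f))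
    (fun f g x => by simp only [map_add, lie_add]; abel)
    (fun c f x => by simp only [map_smul, lie_smul, smul_add])
    (fun f x y => by simp only [map_add, add_lie, LinearMap.add_apply]; abel)
    (fun c f x => by simp only [map_smul, smul_lie, LinearMap.smul_apply, smul_add])
  have hT : ∀ f x, T f x = ⁅α x, j f⁆ + j (φ (β x) f) := fun _ _ => rfl
  have hTA : ∀ f (a : A), T f a = ⁅a, j f⁆ := by
    intro f a
    have h1 : ((β a : B) : L) = ((a - α a : A) : L) :=
      eq_sub_of_add_eq' (hαβ a)
    have h2 := hjk (β a : L) (h1 ▸ (a - α a : A).2) (β (a : L)).2 f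
    have h3 : (⟨(β (a : L) : L), h1 ▸ (a - α a : A).2⟩ : A) = a - α a := Subtype.ext h1
    rw [h3, sub_lie] at h2
    rw [hT]
    change _ = j (φ (β (a : L)) f) at h2
    rw [← h2, add_sub_cancel]
  have hTB : ∀ f (b : B), T f b = j (φ b f) := by
    intro f b
    have h1 : ((α b : A) : L) = ((b - β b : B) : L) :=
      eq_sub_of_add_eq (hαβ b)
    have h2 := hjk (α b : L) (α (b : L)).2 (h1 ▸ (b - β b : B).2) f
    have h3 : (⟨(α (b : L) : L), h1 ▸ (b - β b : B).2⟩ : B) = b - β b := Subtype.ext h1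
    rw [h3, map_sub, LinearMap.sub_apply, map_sub] at h2
    rw [hT]
    change ⁅α (b : L), j f⁆ = _ at h2
    rw [h2, sub_add_cancel]
  -- `Θ v x` is to be `x · v`. As an action is equivariant under `A`, the map `v ↦ (x ↦ x · v)` must
  -- be an `A`-map into `Hom(L, D)`, with `A` acting on `L` by the bracket. The universal property
  -- of `D` over `A` produces it from its values `T` on `F`.
  obtain ⟨Θ, hΘ, hΘj⟩ := exists_lift (B.comap A.incl) (restrictInf A φ)
    (LieModule.toEnd ℂ A (L →ₗ[ℂ] D)) T (by
      intro y f
      ext x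
      rw [LieModule.toEnd_apply_apply, LieHom.lie_apply]
      have hxy : ⁅y.1, x⁆ = ⁅y.1.1, x⁆ := rfl
      have hφ : restrictInf A φ y = φ ⟨y.1.1, y.2⟩ := rfl
      rw [hxy, hφ]
      obtain ⟨a, ha, b, hb, rfl⟩ := hAB x
      rw [lie_add, map_add, map_add, map_add, lie_add]
      have e1 : T f a = ⁅(⟨a, ha⟩ : A), j f⁆ := hTA f ⟨a, ha⟩
      have e2 : T f b = j (φ ⟨b, hb⟩ f) := hTB f ⟨b, hb⟩
      have e3 : T (φ ⟨y.1.1, y.2⟩ f) a = ⁅(⟨a, ha⟩ : A), j (φ ⟨y.1.1, y.2⟩ f)⁆ :=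
        hTA _ ⟨a, ha⟩
      have e4 : T (φ ⟨y.1.1, y.2⟩ f) b = j (φ ⟨b, hb⟩ (φ ⟨y.1.1, y.2⟩ f)) := hTB _ ⟨b, hb⟩
      have e5 : T f ⁅y.1.1, a⁆ = ⁅⁅y.1, (⟨a, ha⟩ : A)⁆, j f⁆ := hTA f ⁅y.1, (⟨a, ha⟩ : A)⁆
      have e6 : T f ⁅y.1.1, b⁆ = j (φ ⁅(⟨y.1.1, y.2⟩ : B), ⟨b, hb⟩⁆ f) :=
        hTB f ⁅(⟨y.1.1, y.2⟩ : B), ⟨b, hb⟩⁆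
      have e7 : ∀ f, ⁅y.1, j f⁆ = j (φ ⟨y.1.1, y.2⟩ f) := hjk y.1.1 y.1.2 y.2
      rw [e1, e2, e3, e4, e5, e6, leibniz_lie y.1, e7, e7, LieHom.map_lie,
        LieRing.of_associative_ring_bracket, LinearMap.sub_apply, map_sub, Module.End.mul_apply,
        Module.End.mul_apply]
      abel)
  have hcomm : ∀ (a : A) v x, Θ ⁅a, v⁆ x = ⁅a, Θ v x⁆ - Θ v ⁅(a : L), x⁆ := fun a v x => by
    rw [hΘ, LieModule.toEnd_apply_apply, LieHom.lie_apply]; rfl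
  have hΘA : ∀ (a : A) v, Θ v a = ⁅a, v⁆ := by
    intro a v
    let S : Submodule ℂ D :=
      { carrier := {v | ∀ a : A, Θ v a = ⁅a, v⁆}
        zero_mem' := fun a => by rw [map_zero, lie_zero, LinearMap.zero_apply]
        add_mem' := fun {v w} hv hw a => by rw [map_add, lie_add, LinearMap.add_apply, hv, hw]
        smul_mem' := fun c v hv a => by rw [map_smul, lie_smul, LinearMap.smul_apply, hv] }
    refine mem_of_lie_mem _ _ S (fun f a => ?_) (fun b v hv a => ?_) v a
    · rw [hΘj, hTA]
    · have h := hv ⁅b, a⁆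
      rw [hcomm, hv]
      change _ - Θ v ((⁅b, a⁆ : A) : L) = _
      rw [h, leibniz_lie b a v, add_sub_cancel_left]
  -- The case `x ∈ A` is the equivariance of `Θ`. On `F`, splitting `x` and `y` leaves the case of
  -- two elements of `B`, where `φ` is a representation. The Jacobi identity shows that the vectors
  -- satisfying the relation are stable under `A`, and `F` generates `D` over `A`.
  have hlie : ∀ v (x y : L), Θ v ⁅x, y⁆ = Θ (Θ v y) x - Θ (Θ v x) y := by
    intro v
    let S : Submodule ℂ D :=
      { carrier := {v | ∀ x y : L, Θ v ⁅x, y⁆ = Θ (Θ v y) x - Θ (Θ v x) y}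
        zero_mem' := fun x y => by simp
        add_mem' := fun {v w} hv hw x y => by
          simp only [map_add, LinearMap.add_apply, hv x y, hw x y]; abel
        smul_mem' := fun c v hv x y => by
          simp only [map_smul, LinearMap.smul_apply, hv x y, smul_sub] }
    have hA : ∀ (a : A) v (y : L), Θ v ⁅(a : L), y⁆ = Θ (Θ v y) a - Θ (Θ v a) y := by
      intro a v y
      rw [hΘA, hΘA, hcomm, sub_sub_cancel]
    refine mem_of_lie_mem _ _ S (fun f x y => ?_) (fun a v hv x y => ?_) v
    · obtain ⟨a, ha, b, hb, rfl⟩ := hAB x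
      obtain ⟨a', ha', b', hb', rfl⟩ := hAB y
      have h1 := hA ⟨a, ha⟩ (j f) (a' + b')
      have h2 := hA ⟨a', ha'⟩ (j f) b
      have h3 : Θ (j f) ⁅b, b'⁆ = Θ (Θ (j f) b') b - Θ (Θ (j f) b) b' := by
        have e : ∀ f (b : B), Θ (j f) b = j (φ b f) := fun f b => by rw [hΘj, hTB]
        have e1 := e f ⁅(⟨b, hb⟩ : B), ⟨b', hb'⟩⁆
        have e2 := e f ⟨b, hb⟩
        have e3 := e f ⟨b', hb'⟩
        have e4 := e (φ ⟨b', hb'⟩ f) ⟨b, hb⟩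
        have e5 := e (φ ⟨b, hb⟩ f) ⟨b', hb'⟩
        change Θ (j f) ⁅b, b'⁆ = _ at e1
        change Θ (j f) b = _ at e2
        change Θ (j f) b' = _ at e3
        change Θ _ b = _ at e4
        change Θ _ b' = _ at e5
        rw [e1, e2, e3, e4, e5, LieHom.map_lie, LieRing.of_associative_ring_bracket,
          LinearMap.sub_apply, map_sub, Module.End.mul_apply, Module.End.mul_apply]
      have h4 : ⁅b, a'⁆ = -⁅a', b⁆ := (lie_skew b a').symm
      change Θ (j f) ⁅a, a' + b'⁆ = Θ (Θ (j f) (a' + b')) a - Θ (Θ (j f) a) (a' + b') at h1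
      change Θ (j f) ⁅a', b⁆ = Θ (Θ (j f) b) a' - Θ (Θ (j f) a') b at h2
      change Θ (j f) _ = _
      rw [add_lie, map_add, h1, lie_add b, map_add (Θ (j f)) ⁅b, a'⁆, h3, h4, map_neg, h2]
      simp only [map_add, LinearMap.add_apply]
      abel
    · simp only [hcomm, map_sub, LinearMap.sub_apply]
      have h1 : ⁅(a : L), ⁅x, y⁆⁆ = ⁅⁅(a : L), x⁆, y⁆ + ⁅x, ⁅(a : L), y⁆⁆ := leibniz_lie _ _ _
      have e1 := hv x y
      have e2 := hv ⁅(a : L), x⁆ y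
      have e3 := hv x ⁅(a : L), y⁆
      rw [h1, map_add, e1, e2, e3, lie_sub]
      abel
  refine ⟨{ Θ.flip with
    map_lie' := fun {x y} => ?_ }, fun a v => hΘA a v, fun b f => ?_⟩
  · ext v
    rw [LieRing.of_associative_ring_bracket]
    exact hlie v x y
  · change Θ (j f) b = _
    rw [hΘj, hTB]

/-- As an `A`-module, the module induced from `B` to `L = A + B` has the universal property of the
module induced from `A ∩ B` to `A`. -/
theorem exists_lift_restriction (hAB : ∀ x : L, ∃ a ∈ A, ∃ b ∈ B, a + b = x)
    (φ : B →ₗ⁅ℂ⁆ Module.End ℂ F) {N : Type*} [AddCommGroup N] [Module ℂ N]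
    (π : A →ₗ⁅ℂ⁆ Module.End ℂ N) (f : F →ₗ[ℂ] N)
    (hf : ∀ (x : L) (hA : x ∈ A) (hB : x ∈ B) e, f (φ ⟨x, hB⟩ e) = π ⟨x, hA⟩ (f e)) :
    ∃ Ψ : Induced B φ →ₗ[ℂ] N, (∀ (a : A) v, Ψ ⁅(a : L), v⁆ = π a (Ψ v)) ∧
      ∀ e, Ψ (incl B φ e) = f e := by
  -- The `L`-map from the module induced from `B` to the extended module is followed by the `A`-map
  -- to `N`.
  obtain ⟨πD, hA, hB⟩ := exists_extended_action hAB φ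
  obtain ⟨Ψ, hΨ, hΨi⟩ := exists_lift B φ πD (incl _ (restrictInf A φ)) fun b e => (hB b e).symm
  obtain ⟨Ψ', hΨ', hΨi'⟩ := exists_lift _ (restrictInf A φ) π f fun x e => hf x.1.1 x.1.2 x.2 e
  exact ⟨Ψ'.comp Ψ, fun a v => by
    rw [LinearMap.comp_apply, hΨ, hA, hΨ', LinearMap.comp_apply], fun e => by
    rw [LinearMap.comp_apply, hΨi, hΨi']⟩

/-- As an `A`-module, the module induced from `B` to `L = A + B` is generated by `F`. -/
theorem mem_of_lie_mem_restriction (hAB : ∀ x : L, ∃ a ∈ A, ∃ b ∈ B, a + b = x)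
    (φ : B →ₗ⁅ℂ⁆ Module.End ℂ F) (T : Submodule ℂ (Induced B φ)) (hF : ∀ e, incl B φ e ∈ T)
    (hT : ∀ a ∈ A, ∀ v ∈ T, ⁅a, v⁆ ∈ T) (v : Induced B φ) : v ∈ T := by
  -- Minimality of `R` yields stability under `L`: the vectors of `R` that `L` sends into `R`
  -- contain `F`, since `B` preserves `F`, and are `A`-stable by the Leibniz rule, hence they
  -- exhaust `R`.
  let R : Submodule ℂ (Induced B φ) := sInf {T | (∀ e, incl B φ e ∈ T) ∧
    ∀ a ∈ A, ∀ v ∈ T, ⁅a, v⁆ ∈ T}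
  have hRF : ∀ e, incl B φ e ∈ R := fun e =>
    Submodule.mem_sInf.2 fun S hS => hS.1 e
  have hRA : ∀ a ∈ A, ∀ v ∈ R, ⁅a, v⁆ ∈ R := fun a ha v hv =>
    Submodule.mem_sInf.2 fun S hS => hS.2 a ha v (Submodule.mem_sInf.1 hv S hS)
  let R' : Submodule ℂ (Induced B φ) :=
    { carrier := {v | v ∈ R ∧ ∀ x : L, ⁅x, v⁆ ∈ R}
      zero_mem' := ⟨R.zero_mem, fun x => by rw [lie_zero]; exact R.zero_mem⟩
      add_mem' := fun hv hw => ⟨R.add_mem hv.1 hw.1, fun x => by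
        rw [lie_add]; exact R.add_mem (hv.2 x) (hw.2 x)⟩
      smul_mem' := fun c v hv => ⟨R.smul_mem c hv.1, fun x => by
        rw [lie_smul]; exact R.smul_mem c (hv.2 x)⟩ }
  have hR' : R ≤ R' := by
    refine sInf_le ⟨fun e => ⟨hRF e, fun x => ?_⟩, fun a ha v hv => ⟨hv.2 a, fun x => ?_⟩⟩
    · obtain ⟨a, ha, b, hb, rfl⟩ := hAB x
      rw [add_lie]
      exact R.add_mem (hRA a ha _ (hRF e)) ((lie_incl B φ ⟨b, hb⟩ e).symm ▸ hRF _)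
    · rw [leibniz_lie]
      exact R.add_mem (hv.2 _) (hRA a ha _ (hv.2 x))
  have hv : v ∈ R := mem_of_lie_mem B φ R hRF (fun x v hv => (hR' hv).2 x) v
  exact Submodule.mem_sInf.1 hv T ⟨hF, hT⟩

end Restriction

/-! ### Tensor products of modules induced from `A` and from `B`. -/

section Tensor

variable {L : Type*} [LieRing L] [LieAlgebra ℂ L] {E F : Type*} [AddCommGroup E] [Module ℂ E]
  [AddCommGroup F] [Module ℂ F] {A B : LieSubalgebra ℂ L}
  (φ : A →ₗ⁅ℂ⁆ Module.End ℂ E) (φ' : B →ₗ⁅ℂ⁆ Module.End ℂ F)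

/-- The tensor product of modules induced from `A` and from `B`, where `L = A + B`, is generated by
`E ⊗ F`. -/
theorem tensor_mem_of_lie_mem (hAB : ∀ x : L, ∃ a ∈ A, ∃ b ∈ B, a + b = x)
    (T : Submodule ℂ (Induced A φ ⊗[ℂ] Induced B φ'))
    (hEF : ∀ e f, incl A φ e ⊗ₜ[ℂ] incl B φ' f ∈ T) (hT : ∀ (x : L), ∀ v ∈ T, ⁅x, v⁆ ∈ T)
    (v : Induced A φ ⊗[ℂ] Induced B φ') : v ∈ T := by
  -- Since `A` preserves `E`, in `a(e ⊗ w) = ae ⊗ w + e ⊗ aw` the first summand is in `T` once all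
  -- of `E ⊗ w` is. So the admissible `w` are stable under `A`, which generates from `F`.
  have h1 : ∀ w e, incl A φ e ⊗ₜ[ℂ] w ∈ T := by
    intro w
    let S : Submodule ℂ (Induced B φ') :=
      ⨅ e, T.comap (TensorProduct.mk ℂ (Induced A φ) (Induced B φ') (incl A φ e))
    have hS : ∀ w, w ∈ S ↔ ∀ e, incl A φ e ⊗ₜ[ℂ] w ∈ T := fun w => by simp [S]
    refine (hS w).1 (mem_of_lie_mem_restriction hAB φ' S (fun f => (hS _).2 fun e => hEF e f) ?_ w)
    intro a ha w hw
    rw [hS] at hw ⊢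
    intro e
    have h := hT a _ (hw e)
    have h' := lie_incl A φ ⟨a, ha⟩ e
    change ⁅a, _⁆ = _ at h'
    rw [TensorProduct.LieModule.lie_tmul_right, h'] at h
    exact (T.add_mem_iff_right (hw _)).1 h
  have h2 : ∀ u w, u ⊗ₜ[ℂ] w ∈ T := by
    intro u
    let S : Submodule ℂ (Induced A φ) :=
      ⨅ w, T.comap ((TensorProduct.mk ℂ (Induced A φ) (Induced B φ')).flip w)
    have hS : ∀ u, u ∈ S ↔ ∀ w, u ⊗ₜ[ℂ] w ∈ T := fun u => by simp [S]
    refine (hS u).1 (mem_of_lie_mem A φ S (fun e => (hS _).2 fun w => h1 w e) ?_ u)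
    intro x u hu
    rw [hS] at hu ⊢
    intro w
    have h := hT x _ (hu w)
    rw [TensorProduct.LieModule.lie_tmul_right] at h
    exact (T.add_mem_iff_left (hu _)).1 h
  induction v using TensorProduct.induction_on with
  | zero => exact T.zero_mem
  | tmul u w => exact h2 u w
  | add s t hs ht => exact T.add_mem hs ht

/-- If `L = A + B`, maps of `(A ∩ B)`-modules from `E ⊗ F` to an `L`-module extend to the tensor
product of the modules induced from `A` and from `B`. -/
theorem tensor_exists_lift (hAB : ∀ x : L, ∃ a ∈ A, ∃ b ∈ B, a + b = x)
    {N : Type*} [AddCommGroup N] [Module ℂ N] (π : L →ₗ⁅ℂ⁆ Module.End ℂ N)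
    (ψ : E →ₗ[ℂ] F →ₗ[ℂ] N)
    (hψ : ∀ (x : L) (hA : x ∈ A) (hB : x ∈ B) e f,
      π x (ψ e f) = ψ (φ ⟨x, hA⟩ e) f + ψ e (φ' ⟨x, hB⟩ f)) :
    ∃ Ψ : Induced A φ ⊗[ℂ] Induced B φ' →ₗ[ℂ] N, (∀ x v, Ψ ⁅x, v⁆ = π x (Ψ v)) ∧
      ∀ e f, Ψ (incl A φ e ⊗ₜ incl B φ' f) = ψ e f := by
  -- An `(A ∩ B)`-map `F → Hom(E, N)` extends to an `A`-map `V_F → Hom(E, N)`. Read as an `A`-map `E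
  -- → Hom(V_F, N)`, it extends to an `L`-map `V_E → Hom(V_F, N)`.
  let π₁ := homRep φ (π.comp A.incl)
  have hπ₁ : ∀ (a : A) g e, π₁ a g e = π a (g e) - g (φ a e) := fun _ _ _ => rfl
  obtain ⟨Ψ₁, hΨ₁, hΨ₁i⟩ := exists_lift_restriction hAB φ' π₁ ψ.flip fun x hA hB f => by
    ext e
    rw [hπ₁]
    change ψ e (φ' ⟨x, hB⟩ f) = π x (ψ e f) - ψ (φ ⟨x, hA⟩ e) f
    rw [hψ x hA hB, add_sub_cancel_left]
  let V := Induced B φ'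
  let π₂ := homRep (LieModule.toEnd ℂ L V) π
  have hπ₂ : ∀ (x : L) g v, π₂ x g v = π x (g v) - g ⁅x, v⁆ := fun _ _ _ => rfl
  obtain ⟨Ψ₂, hΨ₂, hΨ₂i⟩ := exists_lift A φ π₂ Ψ₁.flip fun x e => by
    ext v
    rw [hπ₂]
    change Ψ₁ v (φ x e) = π x (Ψ₁ v e) - Ψ₁ ⁅(x : L), v⁆ e
    rw [hΨ₁, hπ₁, sub_sub_cancel]
  refine ⟨TensorProduct.lift Ψ₂, fun x v => ?_, fun e f => ?_⟩
  · induction v using TensorProduct.induction_on with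
    | zero => simp
    | tmul u w =>
      rw [TensorProduct.LieModule.lie_tmul_right, map_add, TensorProduct.lift.tmul,
        TensorProduct.lift.tmul, TensorProduct.lift.tmul, hΨ₂, hπ₂, sub_add_cancel]
    | add s t hs ht => rw [lie_add, map_add, map_add, map_add, hs, ht]
  · rw [TensorProduct.lift.tmul, hΨ₂i, LinearMap.flip_apply, hΨ₁i, LinearMap.flip_apply]

end Tensor

end Induced

/-! ### Derivatives tested against linear forms. -/

section WeakDerivative

variable {V V' : Type*} [AddCommGroup V] [Module ℂ V] [AddCommGroup V'] [Module ℂ V']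

theorem eq_of_forall_dual_eq {v w : V} (h : ∀ l : Module.Dual ℂ V, l v = l w) : v = w :=
  sub_eq_zero.1 ((Module.forall_dual_apply_eq_zero_iff ℂ _).1 fun l => by
    rw [map_sub, h, sub_self])

theorem mem_of_forall_dual {Z : Submodule ℂ V} {v : V}
    (h : ∀ l : Module.Dual ℂ V, (∀ z ∈ Z, l z = 0) → l v = 0) : v ∈ Z := by
  by_contra hv
  obtain ⟨l, hl, hZ⟩ := Submodule.exists_le_ker_of_notMem hv
  exact hl (h l fun z hz => hZ hz)

/-- A curve in a finite-dimensional subspace has its weak derivative in that subspace. -/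
theorem mem_of_hasDerivAt {v : ℝ → V} {v' : V} {t₀ : ℝ} {Z : Submodule ℂ V} (hZ : ∀ t, v t ∈ Z)
    (hv : ∀ l : Module.Dual ℂ V, HasDerivAt (fun t => l (v t)) (l v') t₀) : v' ∈ Z :=
  mem_of_forall_dual fun l hl => (hv l).unique (by
    rw [show (fun t => l (v t)) = fun _ => 0 from funext fun t => hl _ (hZ t)]
    exact hasDerivAt_const t₀ 0)

/-- The coordinate forms of a basis of `Z` are extended to all of `V`, so that hypotheses about
linear forms on `V` apply to them. -/
theorem exists_coordinates (Z : Submodule ℂ V) [FiniteDimensional ℂ Z] :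
    ∃ (n : ℕ) (b : Fin n → V) (c : Fin n → Module.Dual ℂ V), (∀ i, b i ∈ Z) ∧
      (∀ i j, c i (b j) = if i = j then 1 else 0) ∧ ∀ z ∈ Z, z = ∑ i, c i z • b i := by
  let b := Module.finBasis ℂ Z
  choose c hc using fun i => LinearMap.exists_extend (b.coord i)
  have hcb : ∀ i (z : Z), c i z = b.coord i z := fun i z => LinearMap.congr_fun (hc i) z
  refine ⟨_, fun i => b i, c, fun i => (b i).2, fun i j => ?_, fun z hz => ?_⟩
  · rw [hcb, Module.Basis.coord_apply, Module.Basis.repr_self, Finsupp.single_apply]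
    simp only [eq_comm]
  have h := congrArg Z.subtype (b.sum_repr ⟨z, hz⟩)
  rw [map_sum] at h
  refine h.symm.trans (Finset.sum_congr rfl fun i _ => ?_)
  rw [hcb i ⟨z, hz⟩, map_smul]
  rfl

/-- The product rule for a curve in a finite-dimensional subspace and a curve of linear maps. -/
theorem hasDerivAt_apply {v : ℝ → V} {v' : V} {t₀ : ℝ} {Z : Submodule ℂ V} [FiniteDimensional ℂ Z]
    (hZ : ∀ t, v t ∈ Z) (hv : ∀ l : Module.Dual ℂ V, HasDerivAt (fun t => l (v t)) (l v') t₀)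
    {B : ℝ → V →ₗ[ℂ] V'} {B' : V →ₗ[ℂ] V'} (l : Module.Dual ℂ V')
    (hB : ∀ x, HasDerivAt (fun t => l (B t x)) (l (B' x)) t₀) :
    HasDerivAt (fun t => l (B t (v t))) (l (B t₀ v' + B' (v t₀))) t₀ := by
  -- In coordinates on `Z` the expression is a finite sum of products of scalar functions.
  obtain ⟨n, b, c, -, -, hc⟩ := exists_coordinates Z
  have h : ∀ (T : V →ₗ[ℂ] V') z, z ∈ Z → l (T z) = ∑ i, c i z * l (T (b i)) := by
    intro T z hz
    conv_lhs => rw [hc z hz]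
    simp only [map_sum, map_smul, smul_eq_mul]
  have h1 : (fun t => l (B t (v t))) = fun t => ∑ i, c i (v t) * l (B t (b i)) :=
    funext fun t => h _ _ (hZ t)
  rw [h1, map_add, h _ _ (hZ t₀), h _ _ (mem_of_hasDerivAt hZ hv), ← Finset.sum_add_distrib]
  exact HasDerivAt.fun_sum fun i _ => (hv (c i)).mul (hB (b i))

end WeakDerivative

/-! ### The exponential map of `U(p)` and the derivative of `Ad`. -/

section Exponential

variable {p : ℕ}

theorem expU_add (Y : skewAdjoint (Matrix (Fin p) (Fin p) ℂ)) (s t : ℝ) :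
    expU Y (s + t) = expU Y s * expU Y t := by
  apply Subtype.ext
  change NormedSpace.exp ((s + t) • Y.1) = NormedSpace.exp (s • Y.1) * NormedSpace.exp (t • Y.1)
  rw [add_smul, Matrix.exp_add_of_commute]
  exact ((Commute.refl Y.1).smul_left s).smul_right t

theorem expU_zero (Y : skewAdjoint (Matrix (Fin p) (Fin p) ℂ)) : expU Y 0 = 1 := by
  apply Subtype.ext
  change NormedSpace.exp ((0 : ℝ) • Y.1) = 1
  rw [zero_smul, NormedSpace.exp_zero]

theorem expU_neg (Y : skewAdjoint (Matrix (Fin p) (Fin p) ℂ)) (t : ℝ) :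
    expU Y (-t) = (expU Y t)⁻¹ :=
  eq_inv_of_mul_eq_one_left (by rw [← expU_add, neg_add_cancel, expU_zero])

open scoped Matrix.Norms.L2Operator in
/-- The exponential map of `U(p)` is surjective. -/
theorem exists_expU_eq (k : U p) : ∃ Y, expU Y 1 = k := by
  -- On a finite spectrum every function is continuous, so the functional calculus applies to
  -- `Complex.log` despite its branch cut. The spectrum lies on the unit circle, where `log` is
  -- purely imaginary.
  have hfin : (spectrum ℂ k.1).Finite :=
    (Module.End.finite_spectrum (Matrix.toLin' k.1)).subset (by rw [Matrix.spectrum_toLin'])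
  have hcont : ∀ f : ℂ → ℂ, ContinuousOn f (spectrum ℂ k.1) := fun f => hfin.continuousOn f
  have hunit : k.1 ∈ unitary (Matrix (Fin p) (Fin p) ℂ) := k.2
  have hnorm : IsStarNormal k.1 := ⟨by
    rw [commute_iff_eq, Unitary.star_mul_self_of_mem hunit, Unitary.mul_star_self_of_mem hunit]⟩
  have hz : ∀ z ∈ spectrum ℂ k.1, ‖z‖ = 1 := fun z hz =>
    spectrum.norm_eq_one_of_unitary hunit hz
  refine ⟨⟨cfc Complex.log k.1, ?_⟩, Subtype.ext ?_⟩
  · rw [skewAdjoint.mem_iff, ← cfc_star, ← cfc_neg]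
    refine cfc_congr fun z h => ?_
    apply Complex.ext
    · simp [Complex.log_re, hz z h]
    · simp
  · change NormedSpace.exp ((1 : ℝ) • cfc Complex.log k.1) = k.1
    rw [one_smul, ← CFC.exp_eq_normedSpace_exp (𝕜 := ℂ), ← cfc_comp' _ _ _ ((hfin.image _).continuousOn _) (hcont _)]
    conv_rhs => rw [← cfc_id' ℂ k.1]
    refine cfc_congr fun z h => ?_
    rw [← Complex.exp_eq_exp_ℂ]
    exact Complex.exp_log (norm_ne_zero_iff.1 (by rw [hz z h]; exact one_ne_zero))

open scoped Matrix.Norms.L2Operator in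
/-- The exponential map of `U(p)` has a right inverse near `1` that is continuous at `1`. -/
theorem exists_local_log : ∃ lg : U p → skewAdjoint (Matrix (Fin p) (Fin p) ℂ),
    (∀ᶠ k in nhds 1, expU (lg k) 1 = k) ∧ Filter.Tendsto lg (nhds 1) (nhds 0) := by
  let lg : U p → skewAdjoint (Matrix (Fin p) (Fin p) ℂ) := fun k =>
    ⟨Complex.I • (Unitary.argSelfAdjoint (A := Matrix (Fin p) (Fin p) ℂ) k).1, by
      rw [skewAdjoint.mem_iff, star_smul, (Unitary.argSelfAdjoint _).2.star_eq]
      simp⟩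
  have hball : Metric.ball (1 : unitary (Matrix (Fin p) (Fin p) ℂ)) 2 ∈ nhds 1 :=
    Metric.ball_mem_nhds _ two_pos
  refine ⟨lg, ?_, ?_⟩
  · filter_upwards [hball] with k hk
    have h := expUnitary_argSelfAdjoint (A := Matrix (Fin p) (Fin p) ℂ) (u := k) (by
      simpa [Subtype.dist_eq, dist_eq_norm] using hk)
    apply Subtype.ext
    change NormedSpace.exp ((1 : ℝ) • _) = k.1
    rw [one_smul]
    exact congrArg Subtype.val h
  · rw [tendsto_subtype_rng]
    have h := (Unitary.continuousOn_argSelfAdjoint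
      (A := Matrix (Fin p) (Fin p) ℂ)).continuousAt hball
    have h1 : Unitary.argSelfAdjoint (1 : unitary (Matrix (Fin p) (Fin p) ℂ)) = 0 := by
      have := argSelfAdjoint_expUnitary (A := Matrix (Fin p) (Fin p) ℂ) (x := 0)
        (by rw [norm_zero]; exact Real.pi_pos)
      rwa [selfAdjoint.expUnitary_zero] at this
    rw [ContinuousAt, h1] at h
    have h2 := (continuous_subtype_val.tendsto _).comp h
    have h3 := h2.const_smul Complex.I
    rw [ZeroMemClass.coe_zero, smul_zero] at h3
    exact h3

open scoped Matrix.Norms.L2Operator in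
theorem hasDerivAt_expU (Y : skewAdjoint (Matrix (Fin p) (Fin p) ℂ)) :
    HasDerivAt (fun t : ℝ => (expU Y t).1) Y.1 0 := by
  have h := hasDerivAt_exp_smul_const (𝕂 := ℝ) Y.1 0
  rw [zero_smul, NormedSpace.exp_zero, one_mul] at h
  exact h

open scoped Matrix.Norms.L2Operator in
theorem hasDerivAt_kMat (Y : skewAdjoint (Matrix (Fin p) (Fin p) ℂ)) :
    HasDerivAt (fun t : ℝ => kMat (expU Y t)) (kDiag Y.1).1.1 0 := by
  let T : (Matrix (Fin p) (Fin p) ℂ × Matrix (Fin p) (Fin p) ℂ) →ₗ[ℝ]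
      Matrix (Fin p ⊕ Fin p) (Fin p ⊕ Fin p) ℂ :=
    { toFun := fun x => Matrix.fromBlocks x.1 0 0 x.2ᵀ
      map_add' := fun x y => by simp [Matrix.fromBlocks_add]
      map_smul' := fun c x => by simp [Matrix.fromBlocks_smul] }
  have h2 : HasDerivAt (fun t : ℝ => (expU Y (-t)).1) (-Y.1) 0 := by
    have h := hasDerivAt_exp_smul_const (𝕂 := ℝ) (-Y.1) 0
    simp only [zero_smul, NormedSpace.exp_zero, one_mul] at h
    refine h.congr_of_eventuallyEq (Filter.Eventually.of_forall fun t => ?_)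
    change NormedSpace.exp (-t • Y.1) = NormedSpace.exp (t • -Y.1)
    rw [smul_neg, neg_smul]
  have h := (LinearMap.toContinuousLinearMap T).hasFDerivAt.comp_hasDerivAt (0 : ℝ)
    ((hasDerivAt_expU Y).prodMk h2)
  refine (h.congr_deriv ?_).congr_of_eventuallyEq (Filter.Eventually.of_forall fun t => ?_)
  rotate_left
  · change kMat (expU Y t) = Matrix.fromBlocks (expU Y t).1 0 0 (expU Y (-t)).1ᵀ
    rw [expU_neg]
    rfl
  · change Matrix.fromBlocks _ _ _ _ = Matrix.fromBlocks _ _ _ _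
    rw [Matrix.transpose_neg]

-- The product rule for `k X k⁻¹` along `k = exp(tY)`, after extending the linear form from `sp(2p,
-- ℂ)` to all matrices.
open scoped Matrix.Norms.L2Operator in
theorem hasDerivAt_Ad (Y : skewAdjoint (Matrix (Fin p) (Fin p) ℂ)) (X : Sp p)
    (l : Module.Dual ℂ (Sp p)) :
    HasDerivAt (fun t : ℝ => l (Ad (expU Y t) X)) (l ⁅(kDiag Y.1).1, X⁆) 0 := by
  obtain ⟨l', hl'⟩ := LinearMap.exists_extend (p := (Sp p).toSubmodule) l
  have hl : ∀ x : Sp p, l x = l' x.1 := fun x => (LinearMap.congr_fun hl' x).symm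
  have h1 := hasDerivAt_kMat Y
  have h2 : HasDerivAt (fun t : ℝ => kMat (expU Y t)⁻¹) (-(kDiag Y.1).1.1) 0 := by
    have h : HasDerivAt (fun t : ℝ => kMat (expU Y t)) (kDiag Y.1).1.1 (-0) := by
      rwa [neg_zero]
    have h' := h.scomp 0 (hasDerivAt_neg 0)
    rw [neg_smul, one_smul] at h'
    simpa only [Function.comp_def, expU_neg] using h'
  have h3 := (h1.mul_const X.1).mul h2
  have h4 := ((LinearMap.toContinuousLinearMap l').restrictScalars ℝ).hasFDerivAt.comp_hasDerivAt
    (0 : ℝ) h3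
  have hone : kMat (1 : U p) = 1 := by simp [kMat, Matrix.fromBlocks_one]
  refine (h4.congr_deriv ?_).congr_of_eventuallyEq (Filter.Eventually.of_forall fun t => hl _)
  rw [hl, expU_zero, inv_one, hone, one_mul, mul_one]
  change l' _ = l' ((kDiag Y.1).1.1 * X.1 - X.1 * (kDiag Y.1).1.1)
  rw [mul_neg, sub_eq_add_neg]

theorem Ad_mul (k k' : U p) (X : Sp p) : Ad (k * k') X = Ad k (Ad k' X) := by
  have h : ∀ k k' : U p, kMat (k * k') = kMat k * kMat k' := by
    intro k k'
    simp [kMat, Matrix.fromBlocks_multiply, Matrix.transpose_mul]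
  apply Subtype.ext
  change kMat (k * k') * X.1 * kMat (k * k')⁻¹ = kMat k * (kMat k' * X.1 * kMat k'⁻¹) * kMat k⁻¹
  rw [mul_inv_rev, h, h]
  simp only [Matrix.mul_assoc]

theorem Ad_one (X : Sp p) : Ad 1 X = X := by
  apply Subtype.ext
  change kMat 1 * X.1 * kMat 1⁻¹ = X.1
  have hone : kMat (1 : U p) = 1 := by simp [kMat, Matrix.fromBlocks_one]
  rw [inv_one, hone, one_mul, mul_one]

end Exponential

/-! ### Locally finite differentiable representations of `U(p)`. -/

section SmoothRep

variable {p : ℕ} {V : Type*} [AddCommGroup V] [Module ℂ V]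

/-- A representation `ρ` of `U(p)` is locally finite and differentiable, with derivative `δ`. -/
structure IsSmoothRep (δ : skewAdjoint (Matrix (Fin p) (Fin p) ℂ) → Module.End ℂ V)
    (ρ : Representation ℂ (U p) V) : Prop where
  deriv_add : ∀ Y Y', δ (Y + Y') = δ Y + δ Y'
  deriv_smul : ∀ (r : ℝ) Y, δ (r • Y) = (r : ℂ) • δ Y
  finite : ∀ v : V, FiniteDimensional ℂ (Submodule.span ℂ (Set.range fun k : U p => ρ k v))
  deriv : ∀ (Y : skewAdjoint (Matrix (Fin p) (Fin p) ℂ)) (v : V) (l : Module.Dual ℂ V),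
    HasDerivAt (fun t : ℝ => l (ρ (expU Y t) v)) (l (δ Y v)) 0

theorem kDiag_add (X Y : Matrix (Fin p) (Fin p) ℂ) : kDiag (X + Y) = kDiag X + kDiag Y := by
  apply Subtype.ext
  apply Subtype.ext
  change Matrix.fromBlocks _ _ _ _ = Matrix.fromBlocks _ _ _ _ + Matrix.fromBlocks _ _ _ _
  simp [Matrix.fromBlocks_add, add_comm]

theorem kDiag_smul (c : ℂ) (X : Matrix (Fin p) (Fin p) ℂ) : kDiag (c • X) = c • kDiag X := by
  apply Subtype.ext
  apply Subtype.ext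
  change Matrix.fromBlocks _ _ _ _ = c • Matrix.fromBlocks _ _ _ _
  simp [Matrix.fromBlocks_smul]

theorem kDiag_real_smul (r : ℝ) (Y : skewAdjoint (Matrix (Fin p) (Fin p) ℂ)) :
    kDiag (r • Y).1 = (r : ℂ) • kDiag Y.1 := by
  rw [← kDiag_smul]
  congr 1

/-- Only the actions of `U(p)` and of `𝔲(p)` are kept, so that `𝔨`- and `𝔤`-modules can be compared
with each other. -/
theorem IsKKModule.isSmoothRep [LieRingModule (kAlg p) V] [LieModule ℂ (kAlg p) V]
    {σ : Representation ℂ (U p) V} (h : IsKKModule σ) :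
    IsSmoothRep (fun Y => LieModule.toEnd ℂ (kAlg p) V (kDiag Y.1)) σ where
  deriv_add Y Y' := by
    rw [← map_add, ← kDiag_add]; rfl
  deriv_smul r Y := by
    rw [← map_smul, ← kDiag_real_smul]
  finite := h.finite
  deriv := h.deriv

theorem IsGKModule.isSmoothRep [LieRingModule (Sp p) V] [LieModule ℂ (Sp p) V]
    {ρ : Representation ℂ (U p) V} (h : IsGKModule ρ) :
    IsSmoothRep (fun Y => LieModule.toEnd ℂ (Sp p) V (kDiag Y.1).1) ρ where
  deriv_add Y Y' := by
    rw [← map_add]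
    exact congrArg (fun x : kAlg p => LieModule.toEnd ℂ (Sp p) V x.1) (kDiag_add Y.1 Y'.1)
  deriv_smul r Y := by
    rw [← map_smul]
    exact congrArg (fun x : kAlg p => LieModule.toEnd ℂ (Sp p) V x.1) (kDiag_real_smul r Y)
  finite := h.finite
  deriv := h.deriv

theorem mem_span_orbit (ρ : Representation ℂ (U p) V) (v : V) (k : U p) :
    ρ k v ∈ Submodule.span ℂ (Set.range fun k : U p => ρ k v) :=
  Submodule.subset_span ⟨k, rfl⟩

namespace IsSmoothRep

variable {δ : skewAdjoint (Matrix (Fin p) (Fin p) ℂ) → Module.End ℂ V}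
  {ρ : Representation ℂ (U p) V}

theorem hasDerivAt (h : IsSmoothRep δ ρ) (Y : skewAdjoint (Matrix (Fin p) (Fin p) ℂ)) (v : V)
    (l : Module.Dual ℂ V) (t₀ : ℝ) :
    HasDerivAt (fun t : ℝ => l (ρ (expU Y t) v)) (l (δ Y (ρ (expU Y t₀) v))) t₀ := by
  have h0 := h.deriv Y (ρ (expU Y t₀) v) l
  rw [← sub_self t₀] at h0
  have h1 := h0.comp_sub_const t₀ t₀
  simpa only [← Module.End.mul_apply, ← map_mul, ← expU_add, sub_add_cancel] using h1

theorem hasDerivAt_neg (h : IsSmoothRep δ ρ) (Y : skewAdjoint (Matrix (Fin p) (Fin p) ℂ)) (v : V)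
    (l : Module.Dual ℂ V) (t₀ : ℝ) :
    HasDerivAt (fun t : ℝ => l (ρ (expU Y (-t)) v)) (-l (ρ (expU Y (-t₀)) (δ Y v))) t₀ := by
  have h0 := h.deriv Y v (l.comp (ρ (expU Y (-t₀))))
  rw [← neg_add_cancel (-t₀), neg_neg, add_comm t₀] at h0
  have h1 := (h0.comp_add_const (-t₀) t₀).scomp t₀ (_root_.hasDerivAt_neg t₀)
  simpa only [Function.comp_def, LinearMap.comp_apply, ← Module.End.mul_apply, ← map_mul,
    ← expU_add, neg_smul, one_smul, add_comm _ t₀, neg_add_cancel_left] using h1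

variable {V' : Type*} [AddCommGroup V'] [Module ℂ V']
  {δ' : skewAdjoint (Matrix (Fin p) (Fin p) ℂ) → Module.End ℂ V'} {ρ' : Representation ℂ (U p) V'}

/-- A linear map that commutes with the action of the Lie algebra commutes with that of `U(p)`. -/
theorem map_apply (h : IsSmoothRep δ ρ) (h' : IsSmoothRep δ' ρ') (f : V →ₗ[ℂ] V')
    (hf : ∀ Y v, f (δ Y v) = δ' Y (f v)) (k : U p) (v : V) : f (ρ k v) = ρ' k (f v) := by
  obtain ⟨Y, rfl⟩ := exists_expU_eq k
  -- The curve `ρ'(exp(-tY)) f(ρ(exp(tY)) v)` has derivative zero because `f` intertwines the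
  -- derivatives. Its values at `1` and `0` are compared.
  have key : ρ' (expU Y (-1)) (f (ρ (expU Y 1) v)) = f v := by
    refine eq_of_forall_dual_eq fun l => ?_
    have hd : ∀ t, HasDerivAt (fun t => l (ρ' (expU Y (-t)) (f (ρ (expU Y t) v)))) 0 t := by
      intro t
      have := h.finite v
      have hp := hasDerivAt_apply (fun t => mem_span_orbit ρ v (expU Y t))
        (fun l => h.hasDerivAt Y v l t) (B := fun t => (ρ' (expU Y (-t))).comp f)
        (B' := -((ρ' (expU Y (-t))).comp ((δ' Y).comp f))) l
        (fun x => by simpa using h'.hasDerivAt_neg Y (f x) l t)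
      refine hp.congr_deriv ?_
      simp [hf]
    have hc := is_const_of_deriv_eq_zero (fun t => (hd t).differentiableAt)
      (fun t => (hd t).deriv) 1 0
    simpa [expU_zero] using hc
  rw [← key, ← Module.End.mul_apply, ← map_mul, ← expU_add, add_neg_cancel, expU_zero, map_one,
    Module.End.one_apply]

/-- A linear map that commutes with the action of `U(p)` commutes with that of the Lie algebra. -/
theorem map_derivative (h : IsSmoothRep δ ρ) (h' : IsSmoothRep δ' ρ') (f : V →ₗ[ℂ] V')
    (hf : ∀ k v, f (ρ k v) = ρ' k (f v)) (Y : skewAdjoint (Matrix (Fin p) (Fin p) ℂ)) (v : V) :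
    f (δ Y v) = δ' Y (f v) := by
  refine eq_of_forall_dual_eq fun l => ?_
  have h1 := h.deriv Y v (l.comp f)
  simp only [LinearMap.comp_apply, hf] at h1
  exact h1.unique (h'.deriv Y (f v) l)

end IsSmoothRep

/-- A differentiable one-parameter group in a Banach algebra is an exponential. -/
theorem eq_exp_of_hasDerivAt {A : Type*} [NormedRing A] [NormedAlgebra ℝ A] [CompleteSpace A]
    {γ : ℝ → A} (h0 : γ 0 = 1) (hadd : ∀ s t, γ (s + t) = γ s * γ t) {D : A}
    (hD : HasDerivAt γ D 0) : γ 1 = NormedSpace.exp D := by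
  have _ : NormedAlgebra ℚ A := NormedAlgebra.restrictScalars ℚ ℝ A
  have h1 : ∀ t, HasDerivAt γ (γ t * D) t := fun t => by
    have h := hD
    rw [← sub_self t] at h
    have h2 := (h.comp_sub_const t t).const_mul (γ t)
    simpa only [← hadd, add_sub_cancel] using h2
  -- Since `γ' = γ D`, the product `γ(t) exp(-tD)` is constant.
  have h2 : ∀ t, HasDerivAt (fun t : ℝ => γ t * NormedSpace.exp (t • -D)) 0 t := fun t => by
    refine ((h1 t).mul (hasDerivAt_exp_smul_const' (𝕂 := ℝ) (-D) t)).congr_deriv ?_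
    rw [mul_assoc, ← mul_add, neg_mul, add_neg_cancel, mul_zero]
  have h3 := is_const_of_deriv_eq_zero (fun t => (h2 t).differentiableAt)
    (fun t => (h2 t).deriv) 1 0
  simp only [one_smul, zero_smul, NormedSpace.exp_zero, h0, mul_one] at h3
  have h4 : NormedSpace.exp (-D) * NormedSpace.exp D = 1 := by
    rw [← NormedSpace.exp_add_of_commute (Commute.neg_left (Commute.refl D)), neg_add_cancel,
      NormedSpace.exp_zero]
  rw [← mul_one (γ 1), ← h4, ← mul_assoc, h3, one_mul]

-- One has `M(exp Y) = exp(D Y)`. Near `1` this reads `M(k) = exp(D(log k))`, with `D` continuous by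
-- finite dimension and `log` continuous at `1`. A homomorphism continuous at `1` is continuous.
open scoped Matrix.Norms.L2Operator in
theorem continuous_of_hasDerivAt_expU {n : ℕ} (M : U p →* Matrix (Fin n) (Fin n) ℂ)
    (D : skewAdjoint (Matrix (Fin p) (Fin p) ℂ) →ₗ[ℝ] Matrix (Fin n) (Fin n) ℂ)
    (hM : ∀ Y i j, HasDerivAt (fun t : ℝ => M (expU Y t) i j) (D Y i j) 0) : Continuous M := by
  have hM' : ∀ Y, HasDerivAt (fun t : ℝ => M (expU Y t)) (D Y) 0 := by
    intro Y
    have h : HasDerivAt (fun t : ℝ => ∑ i, ∑ j, M (expU Y t) i j •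
        (Matrix.single i j 1 : Matrix (Fin n) (Fin n) ℂ)) (∑ i, ∑ j, D Y i j •
        (Matrix.single i j 1 : Matrix (Fin n) (Fin n) ℂ)) 0 :=
      HasDerivAt.fun_sum fun i _ => HasDerivAt.fun_sum fun j _ => (hM Y i j).smul_const _
    simpa only [Matrix.smul_single, smul_eq_mul, mul_one, ← Matrix.matrix_eq_sum_single] using h
  have hexp : ∀ Y, M (expU Y 1) = NormedSpace.exp (D Y) := fun Y =>
    eq_exp_of_hasDerivAt (γ := fun t => M (expU Y t)) (by rw [expU_zero, map_one])
      (fun s t => by rw [expU_add, map_mul]) (hM' Y)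
  obtain ⟨lg, hlg, hlg0⟩ := exists_local_log (p := p)
  let incl : skewAdjoint (Matrix (Fin p) (Fin p) ℂ) →ₗ[ℝ] Matrix (Fin p) (Fin p) ℂ :=
    { toFun := Subtype.val
      map_add' := fun _ _ => rfl
      map_smul' := fun _ _ => rfl }
  have : FiniteDimensional ℝ (skewAdjoint (Matrix (Fin p) (Fin p) ℂ)) :=
    FiniteDimensional.of_injective incl Subtype.val_injective
  have : ContinuousSMul ℝ (skewAdjoint (Matrix (Fin p) (Fin p) ℂ)) :=
    ⟨(continuous_fst.smul (continuous_subtype_val.comp continuous_snd)).subtype_mk _⟩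
  have hDc : Continuous D := D.continuous_of_finiteDimensional
  have _ : NormedAlgebra ℚ (Matrix (Fin n) (Fin n) ℂ) := NormedAlgebra.restrictScalars ℚ ℂ _
  refine continuous_of_continuousAt_one M ?_
  have h1 : Filter.Tendsto (fun k => NormedSpace.exp (D (lg k))) (nhds 1)
      (nhds (NormedSpace.exp (D 0))) :=
    ((NormedSpace.exp_continuous.comp hDc).tendsto 0).comp hlg0
  rw [map_zero, NormedSpace.exp_zero] at h1
  rw [ContinuousAt, map_one]
  refine h1.congr' ?_
  filter_upwards [hlg] with k hk
  rw [← hexp, hk]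

/-- The matrix coefficients of a locally finite differentiable representation are continuous. -/
theorem IsSmoothRep.continuous {δ : skewAdjoint (Matrix (Fin p) (Fin p) ℂ) → Module.End ℂ V}
    {ρ : Representation ℂ (U p) V} (h : IsSmoothRep δ ρ) (v : V) (l : Module.Dual ℂ V) :
    Continuous fun k => l (ρ k v) := by
  have := h.finite v
  set Z := Submodule.span ℂ (Set.range fun k : U p => ρ k v)
  obtain ⟨n, b, c, hb, hcb, hc⟩ := exists_coordinates Z
  have hZ : ∀ k, ∀ z ∈ Z, ρ k z ∈ Z := by
    intro k z hz
    have hle : Z ≤ Z.comap (ρ k) := by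
      refine Submodule.span_le.2 ?_
      rintro _ ⟨k', rfl⟩
      change ρ k (ρ k' v) ∈ Z
      rw [← Module.End.mul_apply, ← map_mul]
      exact mem_span_orbit ρ v _
    exact hle hz
  -- The matrices of the representation on the finite-dimensional invariant subspace spanned by the
  -- orbit.
  let M : U p →* Matrix (Fin n) (Fin n) ℂ :=
    { toFun := fun k => Matrix.of fun i j => c i (ρ k (b j))
      map_one' := by
        ext i j
        rw [Matrix.of_apply, map_one, Module.End.one_apply, hcb, Matrix.one_apply]
      map_mul' := fun k k' => by
        ext i j
        rw [Matrix.mul_apply, Matrix.of_apply, map_mul, Module.End.mul_apply]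
        conv_lhs => rw [hc _ (hZ k' _ (hb j))]
        simp only [map_sum, map_smul, smul_eq_mul, Matrix.of_apply, mul_comm] }
  let D : skewAdjoint (Matrix (Fin p) (Fin p) ℂ) →ₗ[ℝ] Matrix (Fin n) (Fin n) ℂ :=
    { toFun := fun Y => Matrix.of fun i j => c i (δ Y (b j))
      map_add' := fun Y Y' => by
        ext i j
        simp [h.deriv_add]
      map_smul' := fun r Y => by
        ext i j
        simp [h.deriv_smul] }
  have hM : Continuous M := continuous_of_hasDerivAt_expU M D fun Y i j => h.deriv Y (b j) (c i)
  have hv : v ∈ Z := by simpa using mem_span_orbit ρ v 1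
  have hsum : (fun k => l (ρ k v)) = fun k => ∑ j, ∑ i, c j v * (M k i j * l (b i)) := by
    funext k
    conv_lhs => rw [hc v hv]
    simp only [map_sum, map_smul, smul_eq_mul]
    refine Finset.sum_congr rfl fun j _ => ?_
    conv_lhs => rw [hc _ (hZ k _ (hb j))]
    simp only [map_sum, map_smul, smul_eq_mul, Finset.mul_sum]
    rfl
  rw [hsum]
  refine continuous_finsetSum _ fun j _ => continuous_finsetSum _ fun i _ => ?_
  exact continuous_const.mul ((hM.matrix_elem i j).mul continuous_const)

end SmoothRep

/-! ### Averaging over the compact group `U(p)`. -/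

section Averaging

variable {p : ℕ}

open scoped Matrix.Norms.L2Operator in
theorem compactSpace_U (p : ℕ) : CompactSpace (U p) := by
  suffices h : IsCompact ((U p : Submonoid (Matrix (Fin p) (Fin p) ℂ)) :
      Set (Matrix (Fin p) (Fin p) ℂ)) from isCompact_iff_compactSpace.1 h
  refine Metric.isCompact_of_isClosed_isBounded ?_ ?_
  · have h : ((U p : Submonoid (Matrix (Fin p) (Fin p) ℂ)) : Set (Matrix (Fin p) (Fin p) ℂ)) =
        {A | A * star A = 1} := by
      ext A
      exact Matrix.mem_unitaryGroup_iff
    rw [h]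
    exact isClosed_eq (continuous_id.mul continuous_star) continuous_const
  · refine (Metric.isBounded_closedBall (x := 0) (r := 1)).subset fun A hA => ?_
    rw [mem_closedBall_zero_iff]
    -- For `p = 0` the matrix ring is zero and its unitary element has norm `0` rather than `1`.
    rcases subsingleton_or_nontrivial (Matrix (Fin p) (Fin p) ℂ) with _ | _
    · rw [Subsingleton.elim A 0, norm_zero]
      exact zero_le_one
    · exact (CStarRing.norm_of_mem_unitary hA).le

/-- Invariant integration over `U(p)`. -/
theorem exists_invariant_mean (p : ℕ) : ∃ I : C(U p, ℂ) →ₗ[ℂ] ℂ,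
    (∀ (f g : C(U p, ℂ)) (k₀ : U p), (∀ k, g k = f (k₀ * k)) → I g = I f) ∧
      ∀ (f : C(U p, ℂ)) (c : ℂ), (∀ k, f k = c) → I f = c := by
  have := compactSpace_U p
  let _ : MeasurableSpace (U p) := borel _
  have : BorelSpace (U p) := ⟨rfl⟩
  -- Normalising on the compact set `⊤` gives the group total mass `1`.
  let m : MeasureTheory.Measure (U p) := MeasureTheory.Measure.haarMeasure ⊤
  have hm : m Set.univ = 1 := MeasureTheory.Measure.haarMeasure_self
  have : MeasureTheory.IsProbabilityMeasure m := ⟨hm⟩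
  have hint : ∀ f : C(U p, ℂ), MeasureTheory.Integrable f m := fun f =>
    f.continuous.integrable_of_hasCompactSupport (HasCompactSupport.of_compactSpace f)
  refine ⟨⟨⟨fun f => ∫ k, f k ∂m, fun f g => MeasureTheory.integral_add (hint f) (hint g)⟩,
    fun c f => MeasureTheory.integral_const_mul c f⟩, fun f g k₀ h => ?_, fun f c h => ?_⟩
  · change ∫ k, g k ∂m = ∫ k, f k ∂m
    simp only [h]
    exact MeasureTheory.integral_mul_left_eq_self (fun k => f k) k₀
  · change ∫ k, f k ∂m = c
    simp [h]

/-- The vector-valued integral of `c`, formed coordinatewise in `Z`. Its characterisation by linear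
forms needs no topology on `N`. -/
theorem exists_average (I : C(U p, ℂ) →ₗ[ℂ] ℂ) {N : Type*} [AddCommGroup N] [Module ℂ N]
    (c : U p → N) (Z : Submodule ℂ N) [FiniteDimensional ℂ Z] (hZ : ∀ k, c k ∈ Z)
    (hc : ∀ l : Module.Dual ℂ N, Continuous fun k => l (c k)) :
    ∃ n : N, ∀ l : Module.Dual ℂ N, l n = I ⟨fun k => l (c k), hc l⟩ := by
  obtain ⟨m, b, d, -, -, hd⟩ := exists_coordinates Z
  refine ⟨∑ i, I ⟨fun k => d i (c k), hc (d i)⟩ • b i, fun l => ?_⟩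
  have h : (⟨fun k => l (c k), hc l⟩ : C(U p, ℂ)) =
      ∑ i, l (b i) • (⟨fun k => d i (c k), hc (d i)⟩ : C(U p, ℂ)) := by
    ext k
    change l (c k) = _
    rw [ContinuousMap.sum_apply]
    conv_lhs => rw [hd _ (hZ k)]
    simp only [map_sum, map_smul, smul_eq_mul]
    exact Finset.sum_congr rfl fun i _ => mul_comm _ _
  rw [h]
  simp only [map_sum, map_smul, smul_eq_mul]
  exact Finset.sum_congr rfl fun i _ => mul_comm _ _

/-- Homomorphisms of `U(p)`-modules out of a finite-dimensional module lift along surjections. -/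
theorem exists_equivariant_lift {W M N : Type*} [AddCommGroup W] [Module ℂ W]
    [FiniteDimensional ℂ W] [AddCommGroup M] [Module ℂ M] [AddCommGroup N] [Module ℂ N]
    {δ : skewAdjoint (Matrix (Fin p) (Fin p) ℂ) → Module.End ℂ W} {σ : Representation ℂ (U p) W}
    {δ' : skewAdjoint (Matrix (Fin p) (Fin p) ℂ) → Module.End ℂ N} {ν : Representation ℂ (U p) N}
    (hσ : IsSmoothRep δ σ) (hν : IsSmoothRep δ' ν) (μ : Representation ℂ (U p) M)
    (f : N →ₗ[ℂ] M) (hf : ∀ k n, f (ν k n) = μ k (f n)) (hsurj : Function.Surjective f)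
    (g : W →ₗ[ℂ] M) (hg : ∀ k x, g (σ k x) = μ k (g x)) :
    ∃ h : W →ₗ[ℂ] N, (∀ k x, h (σ k x) = ν k (h x)) ∧ ∀ x, f (h x) = g x := by
  obtain ⟨I, hinv, hconst⟩ := exists_invariant_mean p
  obtain ⟨f', hf'⟩ := f.exists_rightInverse_of_surjective (LinearMap.range_eq_top.2 hsurj)
  let s : W →ₗ[ℂ] N := f'.comp g
  have hs : ∀ x, f (s x) = g x := fun x => LinearMap.congr_fun hf' (g x)
  let b := Module.finBasis ℂ W
  have hexp : ∀ k x, ν k (s (σ k⁻¹ x)) = ∑ j, b.coord j (σ k⁻¹ x) • ν k (s (b j)) := by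
    intro k x
    conv_lhs => rw [← b.sum_repr (σ k⁻¹ x)]
    simp only [map_sum, map_smul, Module.Basis.coord_apply]
  -- A single finite-dimensional space containing `k s(k⁻¹ x)` for all `k` and `x`; it is available
  -- because `W` has a finite basis.
  let Z : Submodule ℂ N := ⨆ j, Submodule.span ℂ (Set.range fun k : U p => ν k (s (b j)))
  have := fun j => hν.finite (s (b j))
  have hZ : ∀ x k, ν k (s (σ k⁻¹ x)) ∈ Z := fun x k => by
    rw [hexp]
    exact Submodule.sum_mem _ fun j _ => Submodule.smul_mem _ _
      (Submodule.mem_iSup_of_mem j (mem_span_orbit ν _ k))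
  have hc : ∀ x (l : Module.Dual ℂ N), Continuous fun k => l (ν k (s (σ k⁻¹ x))) := by
    intro x l
    simp only [hexp, map_sum, map_smul, smul_eq_mul]
    exact continuous_finsetSum _ fun j _ =>
      ((hσ.continuous x (b.coord j)).comp continuous_inv).mul (hν.continuous (s (b j)) l)
  -- `h` is the average of the conjugates `k s k⁻¹` of a linear lift `s` of `g`. Invariance of the
  -- mean makes it equivariant, and it still lifts `g` since every conjugate does.
  choose h hh using fun x => exists_average I (fun k => ν k (s (σ k⁻¹ x))) Z (hZ x) (hc x)
  refine ⟨⟨⟨h, fun x y => ?_⟩, fun c x => ?_⟩, fun k₀ x => ?_, fun x => ?_⟩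
  · refine eq_of_forall_dual_eq fun l => ?_
    rw [map_add, hh, hh, hh, ← map_add]
    congr 1
    ext k
    simp
  · refine eq_of_forall_dual_eq fun l => ?_
    rw [map_smul, hh, RingHom.id_apply, hh, ← map_smul]
    congr 1
    ext k
    simp
  · refine eq_of_forall_dual_eq fun l => ?_
    change l (h (σ k₀ x)) = l.comp (ν k₀) (h x)
    rw [hh, hh]
    refine (hinv _ _ k₀ fun k => ?_).symm
    change l (ν k₀ (ν k (s (σ k⁻¹ x)))) = l (ν (k₀ * k) (s (σ (k₀ * k)⁻¹ (σ k₀ x))))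
    rw [← Module.End.mul_apply, ← map_mul, ← Module.End.mul_apply (σ _), ← map_mul, mul_inv_rev,
      inv_mul_cancel_right]
  · refine eq_of_forall_dual_eq fun l => ?_
    change l.comp f (h x) = _
    rw [hh]
    refine hconst _ _ fun k => ?_
    change l (f (ν k (s (σ k⁻¹ x)))) = _
    rw [hf, hs, hg, ← Module.End.mul_apply, ← map_mul, mul_inv_cancel, map_one,
      Module.End.one_apply]

end Averaging

/-! ### The tensor product of generalized Verma modules. -/

section Verma

variable {p : ℕ}

theorem exists_qPlus_add_qMinus (x : Sp p) : ∃ a ∈ qPlus p, ∃ b ∈ qMinus p, a + b = x := by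
  have hx := x.2
  rw [← Matrix.fromBlocks_toBlocks x.1, fromBlocks_mem_sp] at hx
  obtain ⟨h1, h2, h3⟩ := hx
  refine ⟨⟨Matrix.fromBlocks x.1.toBlocks₁₁ x.1.toBlocks₁₂ 0 x.1.toBlocks₂₂,
      (fromBlocks_mem_sp _ _ _ _).2 ⟨h1, Matrix.transpose_zero, h3⟩⟩, rfl,
    ⟨Matrix.fromBlocks 0 0 x.1.toBlocks₂₁ 0,
      (fromBlocks_mem_sp _ _ _ _).2 ⟨Matrix.transpose_zero, h2, by simp⟩⟩, rfl, Subtype.ext ?_⟩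
  change Matrix.fromBlocks _ _ _ _ + Matrix.fromBlocks _ _ _ _ = x.1
  rw [Matrix.fromBlocks_add]
  simp only [add_zero, zero_add]
  exact Matrix.fromBlocks_toBlocks x.1

theorem exists_kDiag_eq (x : kAlg p) : ∃ X, kDiag X = x := by
  obtain ⟨X, hX⟩ := (mem_kAlg_iff x.1).1 x.2
  exact ⟨X, Subtype.ext (Subtype.ext hX.symm)⟩

theorem projPlus_of_mem (x : kAlg p) : projPlus p ⟨x.1, x.2.1⟩ = x := by
  obtain ⟨X, rfl⟩ := exists_kDiag_eq x
  rfl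

theorem projMinus_of_mem (x : kAlg p) : projMinus p ⟨x.1, x.2.2⟩ = x := by
  obtain ⟨X, rfl⟩ := exists_kDiag_eq x
  rfl

/-- `𝔨` is spanned over `ℂ` by the real Lie algebra `𝔲(p)`. -/
theorem exists_kDiag_skewAdjoint (x : kAlg p) :
    ∃ Y Y' : skewAdjoint (Matrix (Fin p) (Fin p) ℂ), x = kDiag Y.1 + Complex.I • kDiag Y'.1 := by
  obtain ⟨X, rfl⟩ := exists_kDiag_eq x
  -- The skew-Hermitian part of `X`, and `-i` times its Hermitian part.
  refine ⟨⟨(1 / 2 : ℂ) • (X - star X), ?_⟩, ⟨(-(Complex.I / 2)) • (X + star X), ?_⟩, ?_⟩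
  · rw [skewAdjoint.mem_iff, star_smul, star_sub, star_star, ← smul_neg, neg_sub]
    simp
  · rw [skewAdjoint.mem_iff, star_smul, star_add, star_star, ← neg_smul, add_comm (star X)]
    congr 1
    simp [neg_div]
  · rw [← kDiag_smul, ← kDiag_add, smul_smul]
    have h : Complex.I * (-(Complex.I / 2)) = 1 / 2 := by
      linear_combination (-1 / 2 : ℂ) * Complex.I_mul_I
    rw [h, ← smul_add, sub_add_add_cancel, ← two_smul ℂ, smul_smul]
    norm_num

variable (p) (E : Type u) (F : Type v)
  [AddCommGroup E] [Module ℂ E] [LieRingModule (kAlg p) E] [LieModule ℂ (kAlg p) E]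
  [AddCommGroup F] [Module ℂ F] [LieRingModule (kAlg p) F] [LieModule ℂ (kAlg p) F]

/-- The canonical map from `E ⊗ F` to the tensor product of the generalized Verma modules. -/
def vermaIncl : E ⊗[ℂ] F →ₗ[ℂ] VermaPlus p E ⊗[ℂ] VermaMinus p F :=
  TensorProduct.map (Induced.incl _ _) (Induced.incl _ _)

variable {p E F}

theorem lie_vermaIncl (x : kAlg p) (t : E ⊗[ℂ] F) :
    ⁅x.1, vermaIncl p E F t⁆ = vermaIncl p E F ⁅x, t⁆ := by
  induction t using TensorProduct.induction_on with
  | zero => simp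
  | add s t hs ht => rw [map_add, lie_add, hs, ht, lie_add, map_add]
  | tmul e f =>
    have h1 := Induced.lie_incl (qPlus p) ((LieModule.toEnd ℂ (kAlg p) E).comp (projPlus p))
      ⟨x.1, x.2.1⟩ e
    have h2 := Induced.lie_incl (qMinus p) ((LieModule.toEnd ℂ (kAlg p) F).comp (projMinus p))
      ⟨x.1, x.2.2⟩ f
    rw [LieHom.comp_apply, projPlus_of_mem, LieModule.toEnd_apply_apply] at h1
    rw [LieHom.comp_apply, projMinus_of_mem, LieModule.toEnd_apply_apply] at h2
    rw [vermaIncl, TensorProduct.map_tmul, TensorProduct.LieModule.lie_tmul_right, h1, h2,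
      TensorProduct.LieModule.lie_tmul_right, map_add, TensorProduct.map_tmul,
      TensorProduct.map_tmul]

theorem mem_of_vermaIncl_mem (T : Submodule ℂ (VermaPlus p E ⊗[ℂ] VermaMinus p F))
    (hi : ∀ t, vermaIncl p E F t ∈ T) (hT : ∀ (x : Sp p), ∀ v ∈ T, ⁅x, v⁆ ∈ T)
    (v : VermaPlus p E ⊗[ℂ] VermaMinus p F) : v ∈ T :=
  Induced.tensor_mem_of_lie_mem _ _ exists_qPlus_add_qMinus T (fun e f => hi (e ⊗ₜ f)) hT v

theorem verma_hom_ext {N : Type*} [AddCommGroup N] [Module ℂ N] [LieRingModule (Sp p) N]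
    {f g : VermaPlus p E ⊗[ℂ] VermaMinus p F →ₗ[ℂ] N}
    (hf : ∀ (x : Sp p) v, f ⁅x, v⁆ = ⁅x, f v⁆) (hg : ∀ (x : Sp p) v, g ⁅x, v⁆ = ⁅x, g v⁆)
    (h : ∀ t, f (vermaIncl p E F t) = g (vermaIncl p E F t)) : f = g :=
  LinearMap.ext fun v => mem_of_vermaIncl_mem (LinearMap.eqLocus f g) h (fun x v hv => by
    rw [LinearMap.mem_eqLocus] at hv ⊢
    rw [hf, hg, hv]) v

/-- Existence in the universal property of `U(𝔤) ⊗_{U(𝔨)} (E ⊗ F)`; `verma_hom_ext` is uniqueness.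
-/
theorem exists_verma_lift {N : Type*} [AddCommGroup N] [Module ℂ N]
    (π : Sp p →ₗ⁅ℂ⁆ Module.End ℂ N) (ψ : E ⊗[ℂ] F →ₗ[ℂ] N)
    (hψ : ∀ (x : kAlg p) t, ψ ⁅x, t⁆ = π x.1 (ψ t)) :
    ∃ Ψ : VermaPlus p E ⊗[ℂ] VermaMinus p F →ₗ[ℂ] N, (∀ x v, Ψ ⁅x, v⁆ = π x (Ψ v)) ∧
      ∀ t, Ψ (vermaIncl p E F t) = ψ t := by
  obtain ⟨Ψ, hΨ, hΨi⟩ := Induced.tensor_exists_lift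
    ((LieModule.toEnd ℂ (kAlg p) E).comp (projPlus p))
    ((LieModule.toEnd ℂ (kAlg p) F).comp (projMinus p)) exists_qPlus_add_qMinus π
    (TensorProduct.curry ψ) (by
      intro x hA hB e f
      rw [LieHom.comp_apply, LieHom.comp_apply, projPlus_of_mem ⟨x, hA, hB⟩,
        projMinus_of_mem ⟨x, hA, hB⟩]
      change π x (ψ (e ⊗ₜ f)) = ψ (⁅(⟨x, hA, hB⟩ : kAlg p), e⁆ ⊗ₜ f) +
        ψ (e ⊗ₜ ⁅(⟨x, hA, hB⟩ : kAlg p), f⁆)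
      rw [← map_add, ← TensorProduct.LieModule.lie_tmul_right, hψ])
  refine ⟨Ψ, hΨ, fun t => ?_⟩
  induction t using TensorProduct.induction_on with
  | zero => simp
  | tmul e f => exact hΨi e f
  | add s t hs ht => rw [map_add, map_add, map_add, hs, ht]

/-- The adjoint action of `U(p)` on `sp(2p, ℂ)`, by automorphisms of the Lie algebra. -/
def AdHom (k : U p) : Sp p →ₗ⁅ℂ⁆ Sp p where
  toFun := Ad k
  map_add' x y := Subtype.ext (by
    change kMat k * (x.1 + y.1) * kMat k⁻¹ = kMat k * x.1 * kMat k⁻¹ + kMat k * y.1 * kMat k⁻¹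
    rw [mul_add, add_mul])
  map_smul' c x := Subtype.ext (by
    change kMat k * (c • x.1) * kMat k⁻¹ = c • (kMat k * x.1 * kMat k⁻¹)
    rw [mul_smul_comm, smul_mul_assoc])
  map_lie' {x y} := Subtype.ext (by
    have h : kMat k⁻¹ * kMat k = 1 := by
      simp [kMat, Matrix.fromBlocks_multiply, ← Matrix.transpose_mul]
    have h' : ∀ A : Matrix (Fin p ⊕ Fin p) (Fin p ⊕ Fin p) ℂ, kMat k⁻¹ * (kMat k * A) = A :=
      fun A => by rw [← mul_assoc, h, one_mul]
    change kMat k * (x.1 * y.1 - y.1 * x.1) * kMat k⁻¹ =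
      kMat k * x.1 * kMat k⁻¹ * (kMat k * y.1 * kMat k⁻¹) -
        kMat k * y.1 * kMat k⁻¹ * (kMat k * x.1 * kMat k⁻¹)
    simp only [mul_assoc, h', mul_sub, sub_mul])

/-- In a `𝔤`-module with a compatible action of `U(p)`, the vectors with a finite-dimensional orbit
on which the derivative of `U(p)` is the action of `𝔲(p)`. -/
def smoothVectors {V : Type*} [AddCommGroup V] [Module ℂ V] [LieRingModule (Sp p) V]
    [LieModule ℂ (Sp p) V] (ρ : Representation ℂ (U p) V) : Submodule ℂ V where
  carrier := {v | FiniteDimensional ℂ (Submodule.span ℂ (Set.range fun k : U p => ρ k v)) ∧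
    ∀ (Y : skewAdjoint (Matrix (Fin p) (Fin p) ℂ)) (l : Module.Dual ℂ V),
      HasDerivAt (fun t : ℝ => l (ρ (expU Y t) v)) (l ⁅(kDiag Y.1).1, v⁆) 0}
  zero_mem' := by
    refine ⟨?_, fun Y l => ?_⟩
    · refine Submodule.finiteDimensional_of_le (Submodule.span_le.2 ?_ : _ ≤ (⊥ : Submodule ℂ V))
      rintro _ ⟨k, rfl⟩
      exact map_zero (ρ k)
    · simpa using hasDerivAt_const (0 : ℝ) (0 : ℂ)
  add_mem' := by
    rintro v w ⟨hv, hv'⟩ ⟨hw, hw'⟩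
    refine ⟨?_, fun Y l => ?_⟩
    · refine Submodule.finiteDimensional_of_le (Submodule.span_le.2 ?_ : _ ≤
        Submodule.span ℂ (Set.range fun k : U p => ρ k v) ⊔
          Submodule.span ℂ (Set.range fun k : U p => ρ k w))
      rintro _ ⟨k, rfl⟩
      change ρ k (v + w) ∈ _
      rw [map_add]
      exact Submodule.add_mem_sup (mem_span_orbit ρ v k) (mem_span_orbit ρ w k)
    · simp only [map_add, lie_add]
      exact (hv' Y l).add (hw' Y l)
  smul_mem' := by
    rintro c v ⟨hv, hv'⟩
    refine ⟨?_, fun Y l => ?_⟩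
    · refine Submodule.finiteDimensional_of_le (Submodule.span_le.2 ?_ : _ ≤
        Submodule.span ℂ (Set.range fun k : U p => ρ k v))
      rintro _ ⟨k, rfl⟩
      change ρ k (c • v) ∈ _
      rw [map_smul]
      exact Submodule.smul_mem _ c (mem_span_orbit ρ v k)
    · simp only [map_smul, lie_smul]
      exact (hv' Y l).const_smul c

/-- By compatibility the orbit of `x v` lies in `𝔤 · Z`, where `Z` is the span of the orbit of `v`
and `𝔤` is finite-dimensional. The product rule for `Ad(exp(tY))x · ρ(exp(tY))v` matches the Leibniz
identity for `Y · (x · v)`. -/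
theorem lie_mem_smoothVectors {V : Type*} [AddCommGroup V] [Module ℂ V] [LieRingModule (Sp p) V]
    [LieModule ℂ (Sp p) V] {ρ : Representation ℂ (U p) V}
    (hρ : ∀ (k : U p) (x : Sp p) (v : V), ρ k ⁅x, v⁆ = ⁅Ad k x, ρ k v⁆) (x : Sp p) {v : V}
    (hv : v ∈ smoothVectors ρ) : ⁅x, v⁆ ∈ smoothVectors ρ := by
  obtain ⟨hfin, hder⟩ := hv
  have : FiniteDimensional ℂ (Sp p) :=
    inferInstanceAs (FiniteDimensional ℂ (Sp p).toSubmodule)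
  let Z := Submodule.span ℂ (Set.range fun k : U p => ρ k v)
  have : FiniteDimensional ℂ Z := hfin
  let T : Sp p →ₗ[ℂ] V →ₗ[ℂ] V := (LieModule.toEnd ℂ (Sp p) V : Sp p →ₗ[ℂ] Module.End ℂ V)
  refine ⟨?_, fun Y l => ?_⟩
  · have hZ : FiniteDimensional ℂ (Submodule.map₂ T ⊤ Z) :=
      Module.Finite.iff_fg.2 (Submodule.FG.map₂ T Module.Finite.fg_top (Module.Finite.iff_fg.1 hfin))
    refine Submodule.finiteDimensional_of_le (Submodule.span_le.2 ?_ : _ ≤ Submodule.map₂ T ⊤ Z)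
    rintro _ ⟨k, rfl⟩
    change ρ k ⁅x, v⁆ ∈ _
    rw [hρ]
    exact Submodule.apply_mem_map₂ T Submodule.mem_top (mem_span_orbit ρ v k)
  · have h := hasDerivAt_apply (v := fun t => Ad (expU Y t) x) (Z := ⊤)
      (fun _ => Submodule.mem_top) (hasDerivAt_Ad Y x) (B := fun t => T.flip (ρ (expU Y t) v))
      (B' := T.flip ⁅(kDiag Y.1).1, v⁆) l (fun x => hder Y (l.comp (T x)))
    simp only [expU_zero, map_one, Module.End.one_apply, Ad_one] at h
    simp only [hρ]
    rw [leibniz_lie]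
    exact h

/-- Such an `R` is a `𝔤`-homomorphism into the same module with its action twisted by `Ad k`. The
universal property supplies it, since compatibility of `σ` makes its prescribed restriction to `E ⊗
F` a `𝔨`-map. -/
theorem exists_verma_twist {σ : Representation ℂ (U p) (E ⊗[ℂ] F)} (hσ : IsKKModule σ) (k : U p) :
    ∃ R : Module.End ℂ (VermaPlus p E ⊗[ℂ] VermaMinus p F),
      (∀ (x : Sp p) v, R ⁅x, v⁆ = ⁅Ad k x, R v⁆) ∧
        ∀ t, R (vermaIncl p E F t) = vermaIncl p E F (σ k t) :=
  exists_verma_lift ((LieModule.toEnd ℂ (Sp p) (VermaPlus p E ⊗[ℂ] VermaMinus p F)).comp (AdHom k))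
    ((vermaIncl p E F).comp (σ k)) fun x t => by
      have h := lie_vermaIncl (AdK k x) (σ k t)
      rw [← hσ.compat] at h
      exact h.symm

/-- Compatible operators on a `𝔤`-module that restrict to a representation of `U(p)` on a
generating subspace form a representation. -/
theorem exists_representation {P W : Type*} [AddCommGroup P] [Module ℂ P] [LieRingModule (Sp p) P]
    [LieModule ℂ (Sp p) P] [AddCommGroup W] [Module ℂ W] {σ : Representation ℂ (U p) W}
    (i : W →ₗ[ℂ] P) (hi : ∀ T : Submodule ℂ P, (∀ t, i t ∈ T) →
      (∀ (x : Sp p), ∀ v ∈ T, ⁅x, v⁆ ∈ T) → ∀ v, v ∈ T)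
    (R : U p → Module.End ℂ P) (hR : ∀ k (x : Sp p) v, R k ⁅x, v⁆ = ⁅Ad k x, R k v⁆)
    (hRi : ∀ k t, R k (i t) = i (σ k t)) :
    ∃ ρ : Representation ℂ (U p) P, ∀ k, ρ k = R k := by
  have hone : R 1 = 1 := LinearMap.ext <| hi (LinearMap.eqLocus (R 1) 1)
    (fun t => by rw [LinearMap.mem_eqLocus, hRi, map_one]; rfl) fun x v hv => by
      rw [LinearMap.mem_eqLocus] at hv ⊢
      rw [hR, hv, Ad_one, Module.End.one_apply, Module.End.one_apply]
  have hmul : ∀ k k', R (k * k') = R k * R k' := fun k k' =>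
    LinearMap.ext <| hi (LinearMap.eqLocus (R (k * k')) (R k * R k'))
      (fun t => by
        rw [LinearMap.mem_eqLocus, Module.End.mul_apply, hRi, hRi, hRi, map_mul,
          Module.End.mul_apply]) fun x v hv => by
        rw [LinearMap.mem_eqLocus] at hv ⊢
        rw [hR, hv, Module.End.mul_apply, Module.End.mul_apply, hR, hR, Ad_mul]
  exact ⟨{ toFun := R, map_one' := hone, map_mul' := hmul }, fun _ => rfl⟩

theorem exists_isGKModule {σ : Representation ℂ (U p) (E ⊗[ℂ] F)} (hσ : IsKKModule σ) :
    ∃ ρ : Representation ℂ (U p) (VermaPlus p E ⊗[ℂ] VermaMinus p F), IsGKModule ρ := by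
  choose R hR' hRi using fun k => exists_verma_twist hσ k
  obtain ⟨ρ, hρ⟩ := exists_representation (vermaIncl p E F) mem_of_vermaIncl_mem R hR' hRi
  obtain rfl : R = ρ := funext fun k => (hρ k).symm
  have hρi : ∀ k t, ρ k (vermaIncl p E F t) = vermaIncl p E F (σ k t) := hRi
  -- The smooth vectors form a `𝔤`-stable subspace containing the image of `E ⊗ F`, which generates.
  have hmem : ∀ v, v ∈ smoothVectors ρ := by
    refine mem_of_vermaIncl_mem _ (fun t => ⟨?_, fun Y l => ?_⟩) fun x v hv =>
      lie_mem_smoothVectors hR' x hv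
    · have := hσ.finite t
      refine Submodule.finiteDimensional_of_le (Submodule.span_le.2 ?_ : _ ≤
        (Submodule.span ℂ (Set.range fun k : U p => σ k t)).map (vermaIncl p E F))
      rintro _ ⟨k, rfl⟩
      change ρ k (vermaIncl p E F t) ∈ _
      rw [hρi]
      exact Submodule.mem_map_of_mem (mem_span_orbit σ t k)
    · simp only [hρi, lie_vermaIncl]
      exact hσ.deriv Y t (l.comp (vermaIncl p E F))
  exact ⟨ρ, hR', fun v => (hmem v).1, fun Y v l => (hmem v).2 Y l⟩

/-- No relation between `ρ` and `σ` is needed: `𝔨`-linearity already makes the restriction of `g` to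
`E ⊗ F` equivariant for `σ`. Its equivariant lift `h₀` is `𝔨`-linear by differentiation and extends
to a `𝔤`-map `h`, which is equivariant for `ρ` by `𝔲(p)`-linearity. -/
theorem isProjectiveGKModule_of_isGKModule [FiniteDimensional ℂ E] [FiniteDimensional ℂ F]
    {σ : Representation ℂ (U p) (E ⊗[ℂ] F)} (hσ : IsKKModule σ)
    (ρ : Representation ℂ (U p) (VermaPlus p E ⊗[ℂ] VermaMinus p F)) (hρ : IsGKModule ρ) :
    IsProjectiveGKModule.{max u v, w} ρ := by
  refine ⟨hρ, ?_⟩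
  intro M N _ _ _ _ _ _ _ _ μ ν hμ hν f g hf hg hsurj
  have hσs := hσ.isSmoothRep
  let g₀ : E ⊗[ℂ] F →ₗ[ℂ] M := (g : _ →ₗ[ℂ] M).comp (vermaIncl p E F)
  obtain ⟨h₀, hh₀, hfh₀⟩ := exists_equivariant_lift hσs hν.isSmoothRep μ (f : N →ₗ[ℂ] M) hf hsurj g₀
    (hσs.map_apply hμ.isSmoothRep g₀ fun Y t => by
      change g (vermaIncl p E F ⁅kDiag Y.1, t⁆) = ⁅(kDiag Y.1).1, g (vermaIncl p E F t)⁆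
      rw [← lie_vermaIncl, LieModuleHom.map_lie])
  have hder : ∀ (Y : skewAdjoint (Matrix (Fin p) (Fin p) ℂ)) t, h₀ ⁅kDiag Y.1, t⁆ = ⁅(kDiag Y.1).1, h₀ t⁆ :=
    hσs.map_derivative hν.isSmoothRep h₀ hh₀
  -- Differentiation gives linearity over `𝔲(p)` only; complex linearity extends it to `𝔨`.
  obtain ⟨h, hh, hhi⟩ := exists_verma_lift (LieModule.toEnd ℂ (Sp p) N) h₀ fun x t => by
    obtain ⟨Y, Y', rfl⟩ := exists_kDiag_skewAdjoint x
    rw [add_lie, smul_lie, map_add, map_smul, hder, hder]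
    change _ = ⁅(kDiag Y.1).1 + Complex.I • (kDiag Y'.1).1, h₀ t⁆
    rw [add_lie, smul_lie]
  refine ⟨{ h with map_lie' := fun {x v} => hh x v }, ?_, ?_⟩
  · exact hρ.isSmoothRep.map_apply hν.isSmoothRep h fun Y v => hh _ v
  · have key : (f : N →ₗ[ℂ] M).comp h = g :=
      verma_hom_ext
        (fun x v => by
          rw [LinearMap.comp_apply, hh]
          exact LieModuleHom.map_lie f x (h v))
        (fun x v => LieModuleHom.map_lie g x v)
        (fun t => by rw [LinearMap.comp_apply, hhi, hfh₀]; rfl)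
    exact LieModuleHom.ext fun v => LinearMap.congr_fun key v

end Verma

end

theorem mainTheorem5 (p : ℕ) (E : Type u) (F : Type v)
    [AddCommGroup E] [Module ℂ E] [FiniteDimensional ℂ E]
    [LieRingModule (kAlg p) E] [LieModule ℂ (kAlg p) E]
    [AddCommGroup F] [Module ℂ F] [FiniteDimensional ℂ F]
    [LieRingModule (kAlg p) F] [LieModule ℂ (kAlg p) F]
    (hEF : ∃ σ : Representation ℂ (U p) (E ⊗[ℂ] F), IsKKModule σ) :
    (∃ ρ : Representation ℂ (U p) (VermaPlus p E ⊗[ℂ] VermaMinus p F), IsGKModule ρ) ∧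
    ∀ ρ : Representation ℂ (U p) (VermaPlus p E ⊗[ℂ] VermaMinus p F),
      IsGKModule ρ → IsProjectiveGKModule.{max u v, w} ρ := by
  obtain ⟨σ, hσ⟩ := hEF
  exact ⟨exists_isGKModule hσ, fun ρ hρ => isProjectiveGKModule_of_isGKModule hσ ρ hρ⟩
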